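/- There exists a universal constant $C>0$ such that the following holds. Let $k,l,n\ge 1$ be integers, $r>0$ and $0<\underline\rho<\overline\rho$. Let $\mu=\mathcal N(0,2\overline\rho^{2}I_k)$ on $\mathbb R^k$ and let $d$ be the $\mathbb L_2(\mathbb R^k,\mu)$-distance. Let $\Theta$ be the set of pairs $\theta=(m,\Sigma)$ where $m\in\mathbb R^k$ has Euclidean norm $|m|\le r$ and $\Sigma$ is a symmetric positive definite $k\times k$ matrix with eigenvalues in $[\underline\rho,\overline\rho]$; let $p(\theta,\cdot)=d\mathcal N(m,\Sigma^{2})/d\mu$ denote the density with respect to $\mu$ of the Gaussian distribution with mean $m$ and covariance matrix $\Sigma^2$. Put $$b=\frac{r^{2}}{2\overline\rho^{2}}+k\log\Big(\frac{\sqrt2\,\overline\rho}{\underline\rho}\Big),\qquad M=\sqrt k\,\overline\rho+r,\qquad R=\sqrt{k/2}\;e^{-b/2}\,\underline\rho^{-1},\qquad \mathcal L(\tau)=\frac12\log\Big(\frac{4le^{2b}\tau^{-1}}{1+k(k+1)}\Big),$$ and let $\mathbf T=\{e^{-b/2}\sqrt{p(\theta,\cdot)}\,:\,\theta\in\Theta\}$.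 Then there exists an estimator $\widehat s=\widehat s(X_1,\ldots,X_n)$ with values in $\mathbb L_2(\mathbb R^k,\mu)$ (that is, a measurable function of the observations, not depending on $s$) such that for every bounded probability density $s$ with respect to $\mu$, if $X_1,\ldots,X_n$ are i.i.d. with density $s$ with respect to $\mu$ and $\tau=n^{-1}\|s\|_\infty(1\vee\log\|s\|_\infty)$, where $\|\cdot\|_\infty$ is the norm of $\mathbb L_\infty(\mu)$, then $$C\,\mathbb E_s\big[d^{2}(s,\widehat s)\big]\le \inf_{g,u} d^{2}(s,g\circ u)+l\,k(k+1)\,\tau\,\big[\log(1+2MR)+(\mathcal L(\tau)\vee1)\big],$$ where the infimum runs over all $u=(u_1,\ldots,u_l)\in\mathbf T^{l}$ and all functions $g$ of the form $g(y_1,\ldots,y_l)=\sum_{j=1}^{l}e^{b}q_jy_j^{2}$ with $q\in[0,1]^{l}$, $\sum_{j=1}^{l}q_j=1$ (so that $g\circ u$ runs over the densities with respect to $\mu$ of all the mixtures $\sum_{j=1}^l q_j\,\mathcal N(m_j,\Sigma_j^2)$ with $(m_j,\Sigma_j)\in\Theta$). -/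

import Mathlib

open MeasureTheory ProbabilityTheory
open scoped ENNReal

noncomputable section

namespace GaussianMixture

/-- The sample space `ℝ^k` with its Euclidean structure. -/
abbrev E (k : ℕ) : Type := EuclideanSpace ℝ (Fin k)

/-- The reference probability `μ = N(0, 2 ρhi² I_k)` on `ℝ^k`. -/
def refMeasure (k : ℕ) (ρhi : ℝ) : Measure (E k) :=
  multivariateGaussian 0 ((2 * ρhi ^ 2) • (1 : Matrix (Fin k) (Fin k) ℝ))

/-- The parameter set `Θ` of pairs `(m, Σ)`: `m` lies in the closed Euclidean ball of radius `r`
and `Σ` is symmetric positive definite with all its eigenvalues in `[ρlo, ρhi]`. -/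
def paramSet (k : ℕ) (r ρlo ρhi : ℝ) : Set (E k × Matrix (Fin k) (Fin k) ℝ) :=
  {θ | ‖θ.1‖ ≤ r ∧ θ.2.PosDef ∧ spectrum ℝ θ.2 ⊆ Set.Icc ρlo ρhi}

/-- `p(θ, ·)` for `θ = (m, Σ)`: the density of `N(m, Σ²)` with respect to `μ`. -/
def gaussDensity (k : ℕ) (ρhi : ℝ) (θ : E k × Matrix (Fin k) (Fin k) ℝ) (x : E k) : ℝ :=
  ((multivariateGaussian θ.1 (θ.2 ^ 2)).rnDeriv (refMeasure k ρhi) x).toReal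

/-- `b = r² / (2 ρhi²) + k log (√2 ρhi / ρlo)`. -/
def bConst (k : ℕ) (r ρlo ρhi : ℝ) : ℝ :=
  r ^ 2 / (2 * ρhi ^ 2) + k * Real.log (√2 * ρhi / ρlo)

/-- `M = √k ρhi + r`. -/
def MConst (k : ℕ) (r ρhi : ℝ) : ℝ := √(k : ℝ) * ρhi + r

/-- `R = √(k / 2) e^{-b/2} / ρlo`. -/
def RConst (k : ℕ) (r ρlo ρhi : ℝ) : ℝ :=
  √((k : ℝ) / 2) * Real.exp (-bConst k r ρlo ρhi / 2) * ρlo⁻¹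

/-- `𝓛(τ) = (1/2) log (4 l e^{2b} τ⁻¹ / (1 + k (k + 1)))`. -/
def logTerm (k l : ℕ) (r ρlo ρhi τ : ℝ) : ℝ :=
  1 / 2 * Real.log (4 * l * Real.exp (2 * bConst k r ρlo ρhi) * τ⁻¹ / (1 + k * (k + 1)))

/-- The parametric set `T` of the functions `u(θ, ·) = e^{-b/2} √p(θ, ·)`, `θ ∈ Θ`. -/
def funSet (k : ℕ) (r ρlo ρhi : ℝ) : Set (E k → ℝ) :=
  {u | ∃ θ ∈ paramSet k r ρlo ρhi,
    u = fun x => Real.exp (-bConst k r ρlo ρhi / 2) * √(gaussDensity k ρhi θ x)}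

/-- The functions `g(y) = ∑ j, e^b q_j y_j²` on `ℝ^l`, with `q` in the probability simplex. -/
def linkSet (k l : ℕ) (r ρlo ρhi : ℝ) : Set ((Fin l → ℝ) → ℝ) :=
  {g | ∃ q ∈ stdSimplex ℝ (Fin l),
    g = fun y => ∑ j, Real.exp (bConst k r ρlo ρhi) * q j * y j ^ 2}

/-- `s` is an (essentially) bounded probability density with respect to `μ`. -/
structure IsBoundedDensity {α : Type*} [MeasurableSpace α] (μ : Measure α) (s : α → ℝ) :
    Prop where
  measurable : Measurable s
  nonneg : 0 ≤ᵐ[μ] s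
  lintegral_eq_one : ∫⁻ x, ENNReal.ofReal (s x) ∂μ = 1
  bounded : eLpNorm s ∞ μ < ∞

/-- The (essential) supremum norm `‖s‖_∞`. -/
def supNorm {α : Type*} [MeasurableSpace α] (μ : Measure α) (s : α → ℝ) : ℝ :=
  (eLpNorm s ∞ μ).toReal

/-- `τ = n⁻¹ ‖s‖_∞ (1 ∨ log ‖s‖_∞)`. -/
def tau {α : Type*} [MeasurableSpace α] (μ : Measure α) (n : ℕ) (s : α → ℝ) : ℝ :=
  (n : ℝ)⁻¹ * supNorm μ s * max 1 (Real.log (supNorm μ s))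

/-- The `L₂(μ)`-distance between two functions, with values in `[0, ∞]`. -/
def l2dist {α : Type*} [MeasurableSpace α] (μ : Measure α) (f g : α → ℝ) : ℝ≥0∞ :=
  eLpNorm (fun x => f x - g x) 2 μ

/-- The law of an i.i.d. sample of size `n` with density `s` with respect to `μ`. -/
def sampleLaw {α : Type*} [MeasurableSpace α] (μ : Measure α) (n : ℕ) (s : α → ℝ) :
    Measure (Fin n → α) :=
  Measure.pi fun _ => μ.withDensity fun x => ENNReal.ofReal (s x)

/-- The quadratic risk `𝔼_s [d²(s, ŝ(X₁, …, Xₙ))]`, with values in `[0, ∞]`. -/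
def risk {α : Type*} [MeasurableSpace α] (μ : Measure α) (n : ℕ) (s : α → ℝ)
    (shat : (Fin n → α) → Lp ℝ 2 μ) : ℝ≥0∞ :=
  ∫⁻ X, l2dist μ s (shat X) ^ 2 ∂sampleLaw μ n s

/-- The infimum of `d²(s, g ∘ u)` over the functions `g` above and `u = (u_1, …, u_l) ∈ T^l`. -/
def approxError (k l : ℕ) (r ρlo ρhi : ℝ) (s : E k → ℝ) : ℝ≥0∞ :=
  ⨅ g ∈ linkSet k l r ρlo ρhi, ⨅ u ∈ {u : Fin l → E k → ℝ | ∀ j, u j ∈ funSet k r ρlo ρhi},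
    l2dist (refMeasure k ρhi) s (fun x => g fun j => u j x) ^ 2

end GaussianMixture

end

open GaussianMixture

/-! The estimator is a penalized least squares selector over a finite sup-norm net of Gaussian
mixtures.

Statistics: for the contrast ‖f‖² minus twice the empirical mean of f, the loss of the minimizer is
governed by the centred empirical process at f - f₀, whose variance is at most ‖s‖_∞ ‖f - f₀‖² per
observation. An exponential moment bound (`lintegral_exp_empirical_le`) lets a fraction of the
quadratic loss absorb this variance (`integral_sub_sq_le_of_contrast_le`). What remains has order W
w / n, where W bounds both ‖s‖_∞ and |f - f₀| and w is a log-weight. Since ‖s‖_∞ is unknown, each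
function of the net is truncated at many dyadic levels and the penalty chooses among them
(`exists_estimator_of_finite_family`); the price is the log-cardinality plus 1 ∨ log ‖s‖_∞.

Geometry: in the variable z = x / ρhi every density reads w exp(-‖B z - v‖² / 2 + ‖z‖² / 4). The
reference covariance is twice the largest one allowed, so this decays uniformly like exp(-‖z‖² / 8).
Hence it is Lipschitz in (w, v, B) uniformly in z, with a constant exponential in b
(`abs_component_sub_le`), and a grid of coordinates gives a net whose log-cardinality is at most a
constant times l k (k + 1) (1 + b + log n + log l) (`exists_mixture_net`).

The logarithm of τ⁻¹ in 𝓛(τ) supplies log n up to a loss of order 1 ∨ log ‖s‖_∞, and this factor is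
already present in τ (`add_log_le_mul_logTerm`). -/

namespace GaussianMixture

/-! ### Measurable selection and exponential moments. -/

/-- A finite family of measurable criteria admits a measurable minimizer. -/
lemma exists_measurable_argmin {Ω J : Type*} [MeasurableSpace Ω] [Finite J] [Nonempty J]
    [MeasurableSpace J] [MeasurableSingletonClass J] (c : J → Ω → ℝ)
    (hc : ∀ j, Measurable (c j)) :
    ∃ a : Ω → J, Measurable a ∧ ∀ ω j, c (a ω) ω ≤ c j ω := by
  classical
  cases nonempty_fintype J
  suffices h : ∀ S : Finset J, S.Nonempty →
      ∃ a : Ω → J, Measurable a ∧ ∀ ω, ∀ j ∈ S, c (a ω) ω ≤ c j ω by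
    obtain ⟨a, ha, h⟩ := h Finset.univ Finset.univ_nonempty
    exact ⟨a, ha, fun ω j => h ω j (Finset.mem_univ j)⟩
  intro S hS
  induction hS using Finset.Nonempty.cons_induction with
  | singleton j => exact ⟨fun _ => j, measurable_const, by simp⟩
  | cons j S hj hS ih =>
    obtain ⟨a, ha, h⟩ := ih
    have hca : Measurable fun ω => c (a ω) ω :=
      (measurable_from_prod_countable_left hc : Measurable fun p : Ω × J => c p.2 p.1).comp
        (measurable_id.prodMk ha)
    refine ⟨fun ω => if c j ω ≤ c (a ω) ω then j else a ω,
      Measurable.ite (measurableSet_le (hc j) hca) measurable_const ha, fun ω i hi => ?_⟩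
    rcases Finset.mem_cons.1 hi with rfl | hi
    · by_cases h' : c i ω ≤ c (a ω) ω
      · simp [h']
      · simpa [h'] using (not_le.1 h').le
    · by_cases h' : c j ω ≤ c (a ω) ω
      · simpa [h'] using h'.trans (h ω i hi)
      · simpa [h'] using h ω i hi

/-- Bernstein-type bound for the exponential moment of a centred empirical sum. -/
lemma lintegral_exp_sum_le {α : Type*} [MeasurableSpace α] (Q : Measure α)
    [IsProbabilityMeasure Q] (n : ℕ) {f : α → ℝ} (hf : Measurable f) {B t : ℝ}
    (hB : ∀ x, |f x| ≤ B) (ht : 0 ≤ t) (htB : 2 * t * B ≤ 1) :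
    ∫⁻ X : Fin n → α, ENNReal.ofReal (Real.exp (t * ∑ i, (f (X i) - ∫ x, f x ∂Q)))
        ∂(Measure.pi fun _ => Q) ≤
      ENNReal.ofReal (Real.exp (n * (t ^ 2 * ∫ x, f x ^ 2 ∂Q))) := by
  set m := ∫ x, f x ∂Q with hm
  have hfi : Integrable f Q :=
    Integrable.of_bound hf.aestronglyMeasurable B (.of_forall fun x => by simpa using hB x)
  have hf2i : Integrable (fun x => f x ^ 2) Q := by
    refine Integrable.of_bound (hf.pow_const 2).aestronglyMeasurable (B ^ 2)
      (.of_forall fun x => ?_)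
    rw [norm_pow, Real.norm_eq_abs]
    exact pow_le_pow_left₀ (abs_nonneg _) (hB x) 2
  have hmB : |m| ≤ B := by
    have := norm_integral_le_of_norm_le_const (μ := Q) (f := f) (C := B)
      (.of_forall fun x => by simpa using hB x)
    simpa using this
  set g : α → ℝ := fun x => t * (f x - m) with hg
  have hgm : Measurable g := (hf.sub_const m).const_mul t
  have hg1 : ∀ x, |g x| ≤ 1 := fun x => by
    rw [hg, abs_mul, abs_of_nonneg ht]
    have : |f x - m| ≤ 2 * B := (abs_sub _ _).trans (by linarith [hB x])
    calc t * |f x - m| ≤ t * (2 * B) := mul_le_mul_of_nonneg_left this ht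
      _ ≤ 1 := by linarith
  have hei : Integrable (fun x => Real.exp (g x)) Q := by
    refine Integrable.of_bound (Real.measurable_exp.comp hgm).aestronglyMeasurable (Real.exp 1)
      (.of_forall fun x => ?_)
    rw [Real.norm_eq_abs, abs_of_pos (Real.exp_pos _)]
    exact Real.exp_le_exp.2 ((le_abs_self _).trans (hg1 x))
  have hprod : ∀ X : Fin n → α, Real.exp (t * ∑ i, (f (X i) - m)) =
      ∏ i, Real.exp (g (X i)) := fun X => by
    rw [← Real.exp_sum, Finset.mul_sum]
  have hint : Integrable (fun X : Fin n → α => ∏ i, Real.exp (g (X i)))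
      (Measure.pi fun _ => Q) := Integrable.fintype_prod fun _ => hei
  simp_rw [hprod]
  rw [← ofReal_integral_eq_lintegral_ofReal hint
    (.of_forall fun X => Finset.prod_nonneg fun i _ => (Real.exp_pos _).le)]
  refine ENNReal.ofReal_le_ofReal ?_
  rw [integral_fintype_prod_eq_pow (fun x => Real.exp (g x)), Fintype.card_fin, Real.exp_nat_mul]
  refine pow_le_pow_left₀ (integral_nonneg fun x => (Real.exp_pos _).le) ?_ n
  have hgi : Integrable g Q := (hfi.sub (integrable_const m)).const_mul t
  have hg0 : ∫ x, g x ∂Q = 0 := by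
    simp only [hg]
    rw [integral_const_mul, integral_sub hfi (integrable_const m)]
    simp [hm]
  have hg2 : ∫ x, g x ^ 2 ∂Q = t ^ 2 * (∫ x, f x ^ 2 ∂Q - m ^ 2) := by
    have : ∀ x, g x ^ 2 = t ^ 2 * (f x ^ 2 - 2 * m * f x + m ^ 2) := fun x => by
      simp only [hg]; ring
    simp_rw [this]
    have hi : Integrable (fun x => f x ^ 2 - 2 * m * f x) Q := hf2i.sub (hfi.const_mul _)
    rw [integral_const_mul, integral_add hi (integrable_const _),
      integral_sub hf2i (hfi.const_mul _), integral_const_mul, ← hm]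
    simp only [integral_const, probReal_univ, one_smul]
    ring
  have hg2i : Integrable (fun x => g x ^ 2) Q := by
    refine Integrable.of_bound (hgm.pow_const 2).aestronglyMeasurable (1 ^ 2)
      (.of_forall fun x => ?_)
    rw [norm_pow, Real.norm_eq_abs]
    exact pow_le_pow_left₀ (abs_nonneg _) (hg1 x) 2
  -- The condition 2tB ≤ 1 gives |g| ≤ 1, where e^y ≤ 1 + y + y². The linear term integrates to zero
  -- and the variance is at most the second moment.
  calc ∫ x, Real.exp (g x) ∂Q ≤ ∫ x, (1 + g x + g x ^ 2) ∂Q := by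
        refine integral_mono hei (((integrable_const 1).add hgi).add hg2i) fun x => ?_
        have := (abs_le.1 (Real.abs_exp_sub_one_sub_id_le (hg1 x))).2
        simp only; linarith
    _ = 1 + t ^ 2 * (∫ x, f x ^ 2 ∂Q - m ^ 2) := by
        have hi : Integrable (fun x => 1 + g x) Q := (integrable_const 1).add hgi
        rw [integral_add hi hg2i, integral_add (integrable_const 1) hgi, hg0, hg2]
        simp
    _ ≤ t ^ 2 * ∫ x, f x ^ 2 ∂Q + 1 := by nlinarith [sq_nonneg (t * m)]
    _ ≤ _ := Real.add_one_le_exp _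

/-! ### Bounded densities and the L₂ distance. -/

section BoundedDensity

variable {α : Type*} [MeasurableSpace α] {μ : Measure α} {s : α → ℝ}

lemma IsBoundedDensity.ae_le_supNorm (hs : IsBoundedDensity μ s) :
    ∀ᵐ x ∂μ, s x ≤ supNorm μ s := by
  have hb := hs.bounded
  rw [eLpNorm_exponent_top] at hb
  filter_upwards [ae_le_eLpNormEssSup (f := s) (μ := μ)] with x hx
  have := ENNReal.toReal_mono hb.ne hx
  rw [toReal_enorm] at this
  rw [supNorm, eLpNorm_exponent_top]
  exact (le_abs_self _).trans this

lemma IsBoundedDensity.isProbabilityMeasure (hs : IsBoundedDensity μ s) :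
    IsProbabilityMeasure (μ.withDensity fun x => ENNReal.ofReal (s x)) :=
  ⟨by rw [withDensity_apply _ MeasurableSet.univ, setLIntegral_univ, hs.lintegral_eq_one]⟩

lemma IsBoundedDensity.one_le_supNorm [IsProbabilityMeasure μ] (hs : IsBoundedDensity μ s) :
    1 ≤ supNorm μ s := by
  have h : (1 : ℝ≥0∞) ≤ ENNReal.ofReal (supNorm μ s) := by
    rw [← hs.lintegral_eq_one]
    calc ∫⁻ x, ENNReal.ofReal (s x) ∂μ ≤ ∫⁻ _, ENNReal.ofReal (supNorm μ s) ∂μ :=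
          lintegral_mono_ae (hs.ae_le_supNorm.mono fun x hx => ENNReal.ofReal_le_ofReal hx)
      _ = _ := by simp
  exact ENNReal.one_le_ofReal.1 h

lemma IsBoundedDensity.integral_withDensity (hs : IsBoundedDensity μ s) (f : α → ℝ) :
    ∫ x, f x ∂(μ.withDensity fun x => ENNReal.ofReal (s x)) = ∫ x, s x * f x ∂μ := by
  rw [integral_withDensity_eq_integral_toReal_smul hs.measurable.ennreal_ofReal (by simp)]
  refine integral_congr_ae (hs.nonneg.mono fun x hx => ?_)
  simp only [Pi.zero_apply] at hx
  simp [ENNReal.toReal_ofReal hx]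

lemma IsBoundedDensity.memLp_two [IsFiniteMeasure μ] (hs : IsBoundedDensity μ s) :
    MemLp s 2 μ :=
  MemLp.mono_exponent (q := ∞) ⟨hs.measurable.aestronglyMeasurable, hs.bounded⟩ le_top

lemma l2dist_sq_eq_ofReal {f g : α → ℝ} (hf : MemLp f 2 μ) (hg : MemLp g 2 μ) :
    l2dist μ f g ^ 2 = ENNReal.ofReal (∫ x, (f x - g x) ^ 2 ∂μ) := by
  have h : MemLp (fun x => f x - g x) 2 μ := hf.sub hg
  rw [l2dist, ofReal_integral_eq_lintegral_ofReal h.integrable_sq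
    (.of_forall fun x => sq_nonneg _), eLpNorm_eq_lintegral_rpow_enorm_toReal two_ne_zero (by simp),
    ← ENNReal.rpow_natCast, ← ENNReal.rpow_mul]
  simp only [ENNReal.toReal_ofNat, Nat.cast_ofNat, one_div, isUnit_iff_ne_zero, ne_eq,
    OfNat.ofNat_ne_zero, not_false_eq_true, IsUnit.inv_mul_cancel, ENNReal.rpow_one]
  refine lintegral_congr fun x => ?_
  rw [← sq_abs, ENNReal.ofReal_pow (abs_nonneg _), ← Real.norm_eq_abs, ofReal_norm,
    ← ENNReal.rpow_natCast]
  norm_num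

end BoundedDensity

/-! ### Penalized least squares and adaptation to ‖s‖_∞. -/

section Selection

variable {α : Type*} [MeasurableSpace α] {μ : Measure α} [IsProbabilityMeasure μ] {s : α → ℝ}

lemma memLp_two_of_bounded {f : α → ℝ} (hf : Measurable f) {c : ℝ} (hc : ∀ x, |f x| ≤ c) :
    MemLp f 2 μ :=
  MemLp.of_bound hf.aestronglyMeasurable c (.of_forall fun x => by simpa using hc x)

/-- Exponential deviation bound for the empirical process, compensated by the `L₂(μ)`-norm. -/
lemma lintegral_exp_empirical_le (hs : IsBoundedDensity μ s) {n : ℕ} (hn : 1 ≤ n) {f : α → ℝ}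
    (hf : Measurable f) {W : ℝ} (hfW : ∀ x, |f x| ≤ W) (hW : supNorm μ s ≤ W) :
    ∫⁻ X, ENNReal.ofReal (Real.exp (n / (8 * W) * ((n : ℝ)⁻¹ * ∑ i, f (X i) - ∫ x, s x * f x ∂μ
      - 1 / 8 * ∫ x, f x ^ 2 ∂μ))) ∂sampleLaw μ n s ≤ 1 := by
  have hA := hs.one_le_supNorm
  have hW0 : 0 < W := by linarith
  have hn0 : (0 : ℝ) < n := by exact_mod_cast hn
  have := hs.isProbabilityMeasure
  have hf2 : Integrable (fun x => f x ^ 2) μ := (memLp_two_of_bounded hf hfW).integrable_sq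
  have hF0 : 0 ≤ ∫ x, f x ^ 2 ∂μ := integral_nonneg fun x => sq_nonneg _
  have hvar : ∫ x, s x * f x ^ 2 ∂μ ≤ W * ∫ x, f x ^ 2 ∂μ := by
    rw [← integral_const_mul]
    refine integral_mono_of_nonneg (hs.nonneg.mono fun x hx => ?_) (hf2.const_mul _)
      (hs.ae_le_supNorm.mono fun x hx => ?_)
    · exact mul_nonneg hx (sq_nonneg _)
    · exact mul_le_mul_of_nonneg_right (hx.trans hW) (sq_nonneg _)
  -- With t = 1 / (8W), the variance term n t² W ‖f‖² equals n / (8W) · ‖f‖² / 8, which the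
  -- compensator cancels exactly.
  have key := lintegral_exp_sum_le (μ.withDensity fun x => ENNReal.ofReal (s x)) n hf hfW
    (t := 1 / (8 * W)) (by positivity) (by field_simp; norm_num)
  rw [hs.integral_withDensity, hs.integral_withDensity] at key
  set F := ∫ x, f x ^ 2 ∂μ
  set m := ∫ x, s x * f x ∂μ
  have hsplit : ∀ X : Fin n → α, ENNReal.ofReal (Real.exp (n / (8 * W) *
      ((n : ℝ)⁻¹ * ∑ i, f (X i) - m - 1 / 8 * F))) =
      ENNReal.ofReal (Real.exp (-(n / (8 * W) * (1 / 8 * F)))) *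
        ENNReal.ofReal (Real.exp (1 / (8 * W) * ∑ i, (f (X i) - m))) := fun X => by
    rw [← ENNReal.ofReal_mul (Real.exp_pos _).le, ← Real.exp_add]
    congr 2
    simp only [Finset.sum_sub_distrib, Finset.sum_const, Finset.card_univ, Fintype.card_fin,
      nsmul_eq_mul]
    field_simp
    ring
  simp_rw [hsplit]
  rw [lintegral_const_mul' _ _ ENNReal.ofReal_ne_top]
  refine (mul_le_mul_right key _).trans ?_
  rw [← ENNReal.ofReal_mul (Real.exp_pos _).le, ← Real.exp_add, ENNReal.ofReal_le_one,
    Real.exp_le_one_iff]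
  have h1 : (n : ℝ) * ((1 / (8 * W)) ^ 2 * ∫ x, s x * f x ^ 2 ∂μ) ≤
      n * ((1 / (8 * W)) ^ 2 * (W * F)) := by gcongr
  have h2 : (n : ℝ) * ((1 / (8 * W)) ^ 2 * (W * F)) = n / (8 * W) * (1 / 8 * F) := by
    field_simp
  linarith

/-- Deterministic inequality satisfied by a minimizer of the penalized least squares contrast. -/
lemma integral_sub_sq_le_of_contrast_le (hs : IsBoundedDensity μ s) {f g : α → ℝ}
    (hf : MemLp f 2 μ) (hg : MemLp g 2 μ) {ef eg pf pg : ℝ}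
    (h : ∫ x, f x ^ 2 ∂μ - 2 * ef + pf ≤ ∫ x, g x ^ 2 ∂μ - 2 * eg + pg) :
    ∫ x, (s x - f x) ^ 2 ∂μ ≤ 3 * ∫ x, (s x - g x) ^ 2 ∂μ + 2 * pg - 2 * pf +
      4 * ((ef - eg) - ∫ x, s x * (f x - g x) ∂μ - 1 / 8 * ∫ x, (f x - g x) ^ 2 ∂μ) := by
  have hS := hs.memLp_two
  have hexp : ∀ {u : α → ℝ}, MemLp u 2 μ → ∫ x, (s x - u x) ^ 2 ∂μ =
      ∫ x, s x ^ 2 ∂μ - 2 * ∫ x, s x * u x ∂μ + ∫ x, u x ^ 2 ∂μ := fun {u} hu => by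
    have hsu : Integrable (fun x => s x * u x) μ := hS.integrable_mul hu
    have hi : Integrable (fun x => s x ^ 2 - 2 * (s x * u x)) μ :=
      hS.integrable_sq.sub (hsu.const_mul 2)
    rw [← integral_const_mul, ← integral_sub hS.integrable_sq (hsu.const_mul 2),
      ← integral_add hi hu.integrable_sq]
    congr 1; ext x; ring
  have hlin : ∫ x, s x * (f x - g x) ∂μ = ∫ x, s x * f x ∂μ - ∫ x, s x * g x ∂μ := by
    have h1 : Integrable (fun x => s x * f x) μ := hS.integrable_mul hf
    have h2 : Integrable (fun x => s x * g x) μ := hS.integrable_mul hg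
    rw [← integral_sub h1 h2]
    congr 1; ext x; ring
  -- The compensator enters the contrast inequality as ‖f - g‖² / 4, at most half of ‖s - f‖² + ‖s -
  -- g‖². Absorbing half of ‖s - f‖² and doubling produces the factors 3, 2 and 4.
  have hpar : ∫ x, (f x - g x) ^ 2 ∂μ ≤
      2 * ∫ x, (s x - f x) ^ 2 ∂μ + 2 * ∫ x, (s x - g x) ^ 2 ∂μ := by
    have h1 : Integrable (fun x => (s x - f x) ^ 2) μ := (hS.sub hf).integrable_sq
    have h2 : Integrable (fun x => (s x - g x) ^ 2) μ := (hS.sub hg).integrable_sq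
    rw [← integral_const_mul, ← integral_const_mul,
      ← integral_add (h1.const_mul 2) (h2.const_mul 2)]
    refine integral_mono (hf.sub hg).integrable_sq ((h1.const_mul 2).add (h2.const_mul 2))
      fun x => ?_
    beta_reduce
    nlinarith [sq_nonneg ((s x - f x) + (s x - g x))]
  have h1 := hexp hf
  have h2 := hexp hg
  linarith

/-- Risk bound for a penalized least squares estimator over a finite family. -/
lemma risk_le_of_contrast_minimizer (hs : IsBoundedDensity μ s) {n : ℕ} (hn : 1 ≤ n)
    {J : Type*} [Fintype J] {f : J → α → ℝ} (hf : ∀ j, Measurable (f j)) {c : ℝ}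
    (hc : ∀ j x, |f j x| ≤ c) {pen : J → ℝ} {shat : (Fin n → α) → Lp ℝ 2 μ}
    {sel : (Fin n → α) → J} (hshat : ∀ X, shat X =ᵐ[μ] f (sel X))
    (hsel : ∀ X j, ∫ x, f (sel X) x ^ 2 ∂μ - 2 * ((n : ℝ)⁻¹ * ∑ i, f (sel X) (X i)) + pen (sel X) ≤
      ∫ x, f j x ^ 2 ∂μ - 2 * ((n : ℝ)⁻¹ * ∑ i, f j (X i)) + pen j)
    (j₀ : J) {W w : J → ℝ} {K : ℝ} (hW : ∀ j, supNorm μ s ≤ W j)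
    (hfW : ∀ j x, |f j x - f j₀ x| ≤ W j)
    (hK : ∀ j, 32 * W j * w j / n ≤ 2 * pen j + K) :
    risk μ n s shat ≤ ENNReal.ofReal (3 * ∫ x, (s x - f j₀ x) ^ 2 ∂μ + 2 * |pen j₀| + |K| +
      ∑ j, 32 * W j / n * Real.exp (-w j)) := by
  have hn0 : (0 : ℝ) < n := by exact_mod_cast hn
  have hA := hs.one_le_supNorm
  have hW0 : ∀ j, 0 < W j := fun j => by linarith [hW j]
  have hL : ∀ j, MemLp (f j) 2 μ := fun j => memLp_two_of_bounded (hf j) (hc j)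
  have hD0 : 0 ≤ ∫ x, (s x - f j₀ x) ^ 2 ∂μ := integral_nonneg fun x => sq_nonneg _
  have := hs.isProbabilityMeasure
  have hprob : IsProbabilityMeasure (sampleLaw μ n s) := by
    unfold sampleLaw; infer_instance
  set Y : J → (Fin n → α) → ℝ := fun j X => (n : ℝ)⁻¹ * ∑ i, (f j (X i) - f j₀ (X i))
    - ∫ x, s x * (f j x - f j₀ x) ∂μ - 1 / 8 * ∫ x, (f j x - f j₀ x) ^ 2 ∂μ with hY
  set b := 3 * ∫ x, (s x - f j₀ x) ^ 2 ∂μ + 2 * |pen j₀| + |K| with hb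
  have hb0 : 0 ≤ b := by positivity
  have hpath : ∀ X, l2dist μ s (shat X) ^ 2 ≤ ENNReal.ofReal b +
      ∑ j, ENNReal.ofReal (32 * W j / n * Real.exp (-w j)) *
        ENNReal.ofReal (Real.exp (n / (8 * W j) * Y j X)) := fun X => by
    have hcongr : l2dist μ s (shat X) = l2dist μ s (f (sel X)) :=
      eLpNorm_congr_ae ((hshat X).mono fun x hx => by simp only [hx])
    rw [hcongr, l2dist_sq_eq_ofReal hs.memLp_two (hL _)]
    have h1 := integral_sub_sq_le_of_contrast_le hs (hL (sel X)) (hL j₀) (hsel X j₀)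
    have h2 : (n : ℝ)⁻¹ * ∑ i, f (sel X) (X i) - (n : ℝ)⁻¹ * ∑ i, f j₀ (X i) -
        ∫ x, s x * (f (sel X) x - f j₀ x) ∂μ - 1 / 8 * ∫ x, (f (sel X) x - f j₀ x) ^ 2 ∂μ =
        Y (sel X) X := by
      simp only [hY, Finset.sum_sub_distrib]; ring
    rw [h2] at h1
    -- Here 4Y = (32W / n) y with y = nY / (8W), and y ≤ w + e^{y - w}: a deterministic part for the
    -- penalty to cancel, plus a part with mean at most e^{-w}.
    have h3 : 4 * Y (sel X) X ≤ 32 * W (sel X) * w (sel X) / n + 32 * W (sel X) / n *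
        (Real.exp (-w (sel X)) * Real.exp (n / (8 * W (sel X)) * Y (sel X) X)) := by
      rw [← Real.exp_add]
      have h4 := Real.add_one_le_exp (-w (sel X) + n / (8 * W (sel X)) * Y (sel X) X)
      have h5 : 0 < 32 * W (sel X) / n := div_pos (mul_pos (by norm_num) (hW0 _)) hn0
      have h6 := mul_le_mul_of_nonneg_left h4 h5.le
      have h7 : 32 * W (sel X) / n * (-w (sel X) + n / (8 * W (sel X)) * Y (sel X) X + 1) =
          -(32 * W (sel X) * w (sel X) / n) + 4 * Y (sel X) X + 32 * W (sel X) / n := by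
        have := (hW0 (sel X)).ne'
        field_simp; ring
      linarith
    have h8 : ∫ x, (s x - f (sel X) x) ^ 2 ∂μ ≤ b + 32 * W (sel X) / n * Real.exp (-w (sel X)) *
        Real.exp (n / (8 * W (sel X)) * Y (sel X) X) := by
      have := hK (sel X)
      have := le_abs_self (pen j₀)
      have := le_abs_self K
      rw [mul_assoc]
      linarith
    refine (ENNReal.ofReal_le_ofReal h8).trans ?_
    have h9 : ∀ j, 0 ≤ 32 * W j / n * Real.exp (-w j) := fun j =>
      mul_nonneg (div_nonneg (mul_nonneg (by norm_num) (hW0 _).le) hn0.le) (Real.exp_pos _).le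
    rw [ENNReal.ofReal_add hb0 (mul_nonneg (h9 _) (Real.exp_pos _).le), ENNReal.ofReal_mul (h9 _)]
    gcongr
    -- The selected index depends on the sample; summing over all indices is the union bound.
    exact Finset.single_le_sum (f := fun j => ENNReal.ofReal (32 * W j / n * Real.exp (-w j)) *
      ENNReal.ofReal (Real.exp (n / (8 * W j) * Y j X))) (fun j _ => zero_le)
      (Finset.mem_univ (sel X))
  have hYm : ∀ j, Measurable (Y j) := fun j => by
    refine ((Measurable.const_mul ?_ _).sub_const _).sub_const _
    exact Finset.measurable_sum _ fun i _ =>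
      ((hf j).comp (measurable_pi_apply i)).sub ((hf j₀).comp (measurable_pi_apply i))
  have hem : ∀ j, Measurable fun X => ENNReal.ofReal (Real.exp (n / (8 * W j) * Y j X)) :=
    fun j => (Real.measurable_exp.comp ((hYm j).const_mul _)).ennreal_ofReal
  calc risk μ n s shat ≤ ∫⁻ X, (ENNReal.ofReal b +
      ∑ j, ENNReal.ofReal (32 * W j / n * Real.exp (-w j)) *
        ENNReal.ofReal (Real.exp (n / (8 * W j) * Y j X))) ∂sampleLaw μ n s :=
        lintegral_mono hpath
    _ = ENNReal.ofReal b + ∑ j, ENNReal.ofReal (32 * W j / n * Real.exp (-w j)) *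
        ∫⁻ X, ENNReal.ofReal (Real.exp (n / (8 * W j) * Y j X)) ∂sampleLaw μ n s := by
        rw [lintegral_add_left measurable_const, lintegral_const, measure_univ, mul_one,
          lintegral_finsetSum _ fun j _ => (hem j).const_mul _]
        simp_rw [lintegral_const_mul' _ _ ENNReal.ofReal_ne_top]
    _ ≤ ENNReal.ofReal b + ∑ j, ENNReal.ofReal (32 * W j / n * Real.exp (-w j)) * 1 := by
        gcongr with j
        exact lintegral_exp_empirical_le hs hn ((hf j).sub (hf j₀)) (hfW j) (hW j)
    _ = _ := by
        have h9 : ∀ j, 0 ≤ 32 * W j / n * Real.exp (-w j) := fun j =>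
          mul_nonneg (div_nonneg (mul_nonneg (by norm_num) (hW0 _).le) hn0.le) (Real.exp_pos _).le
        simp_rw [mul_one]
        rw [← ENNReal.ofReal_sum_of_nonneg fun j _ => h9 j, ← ENNReal.ofReal_add hb0
          (Finset.sum_nonneg fun j _ => h9 j)]

/-- Truncating an approximation at a level above the target, or above the approximation itself,
cannot move it away from the target. -/
lemma sq_sub_min_le {u t c : ℝ} (h : u ≤ c ∨ t ≤ c) : (u - min t c) ^ 2 ≤ (u - t) ^ 2 := by
  rcases le_total t c with htc | htc
  · rw [min_eq_left htc]
  · rw [min_eq_right htc]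
    rcases h with h | h
    · nlinarith
    · rw [le_antisymm h htc]

/-- Adaptation to the unknown bound of the density: penalized least squares over the truncations
at all dyadic levels of a finite family of functions. -/
theorem exists_estimator_of_finite_family {ι : Type*} [Fintype ι] [Nonempty ι]
    {t : ι → α → ℝ} (ht : ∀ a, Measurable (t a)) (ht0 : ∀ a x, 0 ≤ t a x) {c : ℝ}
    (htc : ∀ a x, t a x ≤ c) {n : ℕ} (hn : 1 ≤ n) :
    ∃ shat : (Fin n → α) → Lp ℝ 2 μ, StronglyMeasurable shat ∧
      ∀ s, IsBoundedDensity μ s → ∀ a, risk μ n s shat ≤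
        ENNReal.ofReal (3 * ∫ x, (s x - t a x) ^ 2 ∂μ + 768 * ((n : ℝ)⁻¹ * supNorm μ s *
          (Real.log (Fintype.card ι) + max 1 (Real.log (supNorm μ s))))) := by
  -- At level 2^I > c truncation is inactive, so finitely many levels suffice.
  obtain ⟨I, hI⟩ := pow_unbounded_of_one_lt c (one_lt_two : (1 : ℝ) < 2)
  have hn0 : (0 : ℝ) < n := by exact_mod_cast hn
  have hN1 : (1 : ℝ) ≤ Fintype.card ι := by exact_mod_cast Fintype.card_pos
  have hlN := Real.log_nonneg hN1
  set N : ℝ := (Fintype.card ι : ℝ) with hN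
  let J := Fin (I + 1) × ι
  let f : J → α → ℝ := fun j x => min (t j.2 x) (2 ^ (j.1 : ℕ))
  -- Then e^{-w i} = N⁻¹ 4^{-i}: the N⁻¹ pays for the family, and 4^{-i} beats the growth 2^i of W,
  -- leaving a geometric series.
  let w : ℕ → ℝ := fun i => Real.log N + i * Real.log 4
  have hl4 : 0 ≤ Real.log 4 := Real.log_nonneg (by norm_num)
  have hw0 : ∀ i, 0 ≤ w i := fun i => by positivity
  have hwmono : ∀ {i i' : ℕ}, i ≤ i' → w i ≤ w i' := fun {i i'} h => by
    have : (i : ℝ) ≤ i' := by exact_mod_cast h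
    simp only [w]; gcongr
  -- Twice the penalty is exactly 32 W w / n when W = 2^i.
  let pen : J → ℝ := fun j => 16 * 2 ^ (j.1 : ℕ) * w j.1 / n
  have hf : ∀ j, Measurable (f j) := fun j => (ht j.2).min measurable_const
  have hf0 : ∀ j x, 0 ≤ f j x := fun j x => le_min (ht0 _ _) (by positivity)
  have hfi : ∀ j x, f j x ≤ 2 ^ (j.1 : ℕ) := fun j x => min_le_right _ _
  have hfc : ∀ j x, |f j x| ≤ c := fun j x => by
    rw [abs_of_nonneg (hf0 j x)]
    exact (min_le_left _ _).trans (htc _ _)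
  let crit : J → (Fin n → α) → ℝ := fun j X =>
    ∫ x, f j x ^ 2 ∂μ - 2 * ((n : ℝ)⁻¹ * ∑ i, f j (X i)) + pen j
  have hcrit : ∀ j, Measurable (crit j) := fun j => by
    refine (measurable_const.sub (Measurable.const_mul (Measurable.const_mul ?_ _) _)).add_const _
    exact Finset.measurable_sum _ fun i _ => (hf j).comp (measurable_pi_apply i)
  -- With the discrete σ-algebra on indices, every function of the selected index is strongly
  -- measurable.
  let _ : MeasurableSpace ι := ⊤
  have : MeasurableSingletonClass ι := ⟨fun _ => trivial⟩
  obtain ⟨sel, hsel, hmin⟩ := exists_measurable_argmin crit hcrit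
  have hL : ∀ j, MemLp (f j) 2 μ := fun j => memLp_two_of_bounded (hf j) (hfc j)
  refine ⟨fun X => (hL (sel X)).toLp (f (sel X)),
    (StronglyMeasurable.of_discrete (f := fun j => (hL j).toLp (f j))).comp_measurable hsel,
    fun s hs a => ?_⟩
  have hA := hs.one_le_supNorm
  set A := supNorm μ s with hAdef
  obtain ⟨m, hm1, hm2⟩ := exists_nat_pow_near hA (one_lt_two : (1 : ℝ) < 2)
  -- Since 2^m ≤ A < 2^(m+1), the oracle level 2^i₀ either exceeds ‖s‖_∞ or does not truncate at
  -- all, and it is at most 2A.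
  set i₀ := min I (m + 1) with hi₀
  let j₀ : J := (⟨i₀, by omega⟩, a)
  set A' := max A (2 ^ i₀) with hA'
  have hA'1 : 1 ≤ A' := hA.trans (le_max_left _ _)
  have hA'2 : A' ≤ 2 * A := by
    refine max_le (by linarith) ?_
    calc (2 : ℝ) ^ i₀ ≤ 2 ^ (m + 1) := pow_le_pow_right₀ (by norm_num) (min_le_right _ _)
      _ = 2 * 2 ^ m := by ring
      _ ≤ 2 * A := by linarith
  have hbound := risk_le_of_contrast_minimizer hs hn hf hfc (pen := pen)
    (shat := fun X => (hL (sel X)).toLp (f (sel X))) (sel := sel)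
    (fun X => MemLp.coeFn_toLp _) hmin j₀ (W := fun j => max A' (2 ^ (j.1 : ℕ)))
    (w := fun j => w j.1) (K := 32 * A' * w i₀ / n)
    (fun j => (le_max_left _ _).trans (le_max_left _ _)) ?_ ?_
  · refine hbound.trans (ENNReal.ofReal_le_ofReal ?_)
    have hD : ∫ x, (s x - f j₀ x) ^ 2 ∂μ ≤ ∫ x, (s x - t a x) ^ 2 ∂μ := by
      have hta : MemLp (t a) 2 μ := memLp_two_of_bounded (c := c) (ht a) fun x => by
        rw [abs_of_nonneg (ht0 a x)]; exact htc a x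
      refine integral_mono_ae (hs.memLp_two.sub (hL j₀)).integrable_sq
        (hs.memLp_two.sub hta).integrable_sq (hs.ae_le_supNorm.mono fun x hx => ?_)
      refine sq_sub_min_le ?_
      rcases le_total I (m + 1) with h | h
      · right
        change t a x ≤ 2 ^ i₀
        rw [hi₀, min_eq_left h]
        exact (htc a x).trans hI.le
      · left
        change s x ≤ 2 ^ i₀
        rw [hi₀, min_eq_right h]
        exact hx.trans hm2.le
    have hpen0 : 0 ≤ pen j₀ := div_nonneg (mul_nonneg (by positivity) (hw0 _)) hn0.le
    have hpen : pen j₀ ≤ 16 * A' * w i₀ / n := by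
      have : (2 : ℝ) ^ i₀ ≤ A' := le_max_right _ _
      have := hw0 i₀
      change 16 * (2 : ℝ) ^ i₀ * w i₀ / n ≤ _
      gcongr
    have hK0 : 0 ≤ 32 * A' * w i₀ / n := div_nonneg (mul_nonneg (by positivity) (hw0 _)) hn0.le
    have hsum : ∑ j : J, 32 * max A' (2 ^ (j.1 : ℕ)) / n * Real.exp (-w j.1) ≤ 128 * A' / n := by
      have hterm : ∀ j : J, 32 * max A' (2 ^ (j.1 : ℕ)) / n * Real.exp (-w j.1) ≤
          32 * A' / n * (1 / N * (1 / 2) ^ (j.1 : ℕ)) := fun j => by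
        have he : Real.exp (-w j.1) = 1 / N * (1 / 4) ^ (j.1 : ℕ) := by
          simp only [w]
          rw [neg_add, Real.exp_add, Real.exp_neg, Real.exp_log (by linarith), Real.exp_neg,
            Real.exp_nat_mul, Real.exp_log (by norm_num)]
          simp
        have hle : max A' ((2 : ℝ) ^ (j.1 : ℕ)) ≤ A' * 2 ^ (j.1 : ℕ) := by
          have : (1 : ℝ) ≤ 2 ^ (j.1 : ℕ) := one_le_pow₀ (by norm_num)
          refine max_le ?_ ?_ <;> nlinarith
        rw [he]
        calc 32 * max A' (2 ^ (j.1 : ℕ)) / n * (1 / N * (1 / 4) ^ (j.1 : ℕ))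
            ≤ 32 * (A' * 2 ^ (j.1 : ℕ)) / n * (1 / N * (1 / 4) ^ (j.1 : ℕ)) := by gcongr
          _ = 32 * A' / n * (1 / N * (2 ^ (j.1 : ℕ) * (1 / 4) ^ (j.1 : ℕ))) := by ring
          _ = _ := by rw [← mul_pow]; norm_num
      refine (Finset.sum_le_sum fun j _ => hterm j).trans ?_
      rw [← Finset.mul_sum, Fintype.sum_prod_type]
      simp only [Finset.sum_const, Finset.card_univ, nsmul_eq_mul]
      have hg : ∑ i : Fin (I + 1), (N * (1 / N * (1 / 2 : ℝ) ^ (i : ℕ))) ≤ 2 := by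
        have : ∀ i : Fin (I + 1), N * (1 / N * (1 / 2 : ℝ) ^ (i : ℕ)) = (1 / 2) ^ (i : ℕ) :=
          fun i => by field_simp
        simp_rw [this]
        rw [Fin.sum_univ_eq_sum_range (fun i => (1 / 2 : ℝ) ^ i)]
        have := sum_geometric_two_le (I + 1)
        simpa using this
      calc 32 * A' / n * _ ≤ 32 * A' / n * 2 := by gcongr
        _ ≤ _ := by
          have : 0 ≤ A' / n := by positivity
          have h1 : 32 * A' / n * 2 = 64 * (A' / n) := by ring
          have h2 : 128 * A' / n = 128 * (A' / n) := by ring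
          linarith
    have hw : w i₀ ≤ Real.log N + 4 * max 1 (Real.log A) := by
      have h1 : (i₀ : ℝ) ≤ m + 1 := by exact_mod_cast min_le_right _ _
      have h4 : Real.log 4 = 2 * Real.log 2 := by
        rw [show (4 : ℝ) = 2 ^ 2 by norm_num, Real.log_pow]; norm_num
      have h2 : m * Real.log 2 ≤ Real.log A := by
        rw [← Real.log_pow]; exact Real.log_le_log (by positivity) hm1
      have h3 : Real.log 2 ≤ 1 := by linarith [Real.log_two_lt_d9]
      have h5 := mul_le_mul_of_nonneg_right h1 hl4
      have := le_max_left 1 (Real.log A)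
      have := le_max_right 1 (Real.log A)
      simp only [w]
      nlinarith
    rw [abs_of_nonneg hpen0, abs_of_nonneg hK0]
    have hfin : 64 * A' * w i₀ / n + 128 * A' / n ≤ 768 * ((n : ℝ)⁻¹ * A *
        (Real.log N + max 1 (Real.log A))) := by
      have h1 : 64 * A' * w i₀ / n + 128 * A' / n = (n : ℝ)⁻¹ * (A' * (64 * w i₀ + 128)) := by
        ring
      have h2 : 768 * ((n : ℝ)⁻¹ * A * (Real.log N + max 1 (Real.log A))) =
        (n : ℝ)⁻¹ * (2 * A * (384 * (Real.log N + max 1 (Real.log A)))) := by ring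
      rw [h1, h2]
      have := le_max_left 1 (Real.log A)
      have := hw0 i₀
      gcongr
      linarith
    have h64 : 2 * (16 * A' * w i₀ / n) + 32 * A' * w i₀ / n = 64 * A' * w i₀ / n := by ring
    linarith
  · intro j x
    refine abs_sub_le_of_nonneg_of_le (hf0 _ _) ((hfi _ _).trans (le_max_right _ _)) (hf0 _ _) ?_
    exact (hfi j₀ x).trans ((le_max_right A _).trans (le_max_left _ _))
  · intro j
    have hwj := hw0 j.1
    have hpj : 2 * pen j = 32 * 2 ^ (j.1 : ℕ) * w j.1 / n := by simp only [pen]; ring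
    rw [hpj]
    have hKnn : 0 ≤ 32 * A' * w i₀ / n := div_nonneg (mul_nonneg (by positivity) (hw0 _)) hn0.le
    have hpnn : 0 ≤ 32 * (2 : ℝ) ^ (j.1 : ℕ) * w j.1 / n :=
      div_nonneg (mul_nonneg (by positivity) (hw0 _)) hn0.le
    -- Levels up to i₀ have W = A' and are covered by K. A level strictly between i₀ and I + 1
    -- forces i₀ = m + 1, so W = 2^i and the penalty suffices.
    rcases le_or_gt (j.1 : ℕ) i₀ with h | h
    · have h1 : max A' ((2 : ℝ) ^ (j.1 : ℕ)) = A' := by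
        refine max_eq_left (le_trans ?_ (le_max_right _ _))
        exact pow_le_pow_right₀ (by norm_num) h
      have h2 := hwmono h
      have h3 : 32 * A' * w j.1 / n ≤ 32 * A' * w i₀ / n := by gcongr
      simp only [h1]
      linarith
    · have hlt : m + 1 < j.1 := by have := j.1.2; omega
      have h1 : max A' ((2 : ℝ) ^ (j.1 : ℕ)) = 2 ^ (j.1 : ℕ) := by
        refine max_eq_right (max_le ?_ ?_)
        · exact hm2.le.trans (pow_le_pow_right₀ (by norm_num) hlt.le)
        · exact pow_le_pow_right₀ (by norm_num) h.le
      simp only [h1]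
      linarith

end Selection

/-! ### Densities of multivariate Gaussian distributions -/

lemma map_withDensity_of_leftInverse {α β : Type*} [MeasurableSpace α] [MeasurableSpace β]
    (ν : Measure α) {g : α → β} (hg : Measurable g) {h : β → α} (hh : Measurable h)
    (hgh : Function.LeftInverse h g) {φ : α → ℝ≥0∞} (hφ : Measurable φ) :
    (ν.withDensity φ).map g = (ν.map g).withDensity (φ ∘ h) := by
  ext s hs
  rw [Measure.map_apply hg hs, withDensity_apply _ (hg hs), withDensity_apply _ hs,
    setLIntegral_map hs (hφ.comp hh) hg]
  simp [hgh _]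

lemma pi_withDensity_ofReal {ι : Type*} [Fintype ι] {X : ι → Type*}
    [∀ i, MeasurableSpace (X i)] (ν : ∀ i, Measure (X i)) [∀ i, SigmaFinite (ν i)]
    {f : ∀ i, X i → ℝ} (hf : ∀ i, Integrable (f i) (ν i)) (hf0 : ∀ i x, 0 ≤ f i x) :
    Measure.pi (fun i => (ν i).withDensity fun x => ENNReal.ofReal (f i x)) =
      (Measure.pi ν).withDensity fun x => ENNReal.ofReal (∏ i, f i (x i)) := by
  refine Measure.pi_eq fun s hs => ?_
  rw [withDensity_apply _ (MeasurableSet.univ_pi hs), Measure.restrict_pi_pi,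
    ← ofReal_integral_eq_lintegral_ofReal
      (Integrable.fintype_prod_dep fun i => (hf i).restrict)
      (.of_forall fun x => Finset.prod_nonneg fun i _ => hf0 i _),
    integral_fintype_prod_eq_prod, ENNReal.ofReal_prod_of_nonneg
      fun i _ => integral_nonneg (hf0 i)]
  refine Finset.prod_congr rfl fun i _ => ?_
  rw [withDensity_apply _ (hs i), ofReal_integral_eq_lintegral_ofReal (hf i).restrict
    (.of_forall fun x => hf0 i x)]

variable {k : ℕ}

lemma stdGaussian_eq_withDensity :
    stdGaussian (E k) = volume.withDensity fun x =>
      ENNReal.ofReal ((√(2 * Real.pi))⁻¹ ^ k * Real.exp (-‖x‖ ^ 2 / 2)) := by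
  have h1 : gaussianReal 0 1 =
      volume.withDensity fun x => ENNReal.ofReal (gaussianPDFReal 0 1 x) :=
    gaussianReal_of_var_ne_zero 0 one_ne_zero
  have hmeas : Measurable fun x : Fin k → ℝ =>
      ENNReal.ofReal (∏ i, gaussianPDFReal 0 1 (x i)) := by
    refine (Finset.measurable_prod _ fun i _ => ?_).ennreal_ofReal
    exact (measurable_gaussianPDFReal 0 1).comp (measurable_pi_apply i)
  rw [← map_pi_eq_stdGaussian, h1, pi_withDensity_ofReal _
    (fun _ => integrable_gaussianPDFReal 0 1) (fun _ => gaussianPDFReal_nonneg 0 1),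
    map_withDensity_of_leftInverse _ (WithLp.measurable_toLp 2 _) (WithLp.measurable_ofLp 2 _)
      (fun _ => rfl) hmeas, ← volume_pi, (PiLp.volume_preserving_toLp (Fin k)).map_eq]
  congr 1
  ext x
  simp only [Function.comp, gaussianPDFReal_def, Finset.prod_mul_distrib, Finset.prod_const,
    Finset.card_univ, Fintype.card_fin, ← Real.exp_sum, EuclideanSpace.real_norm_sq_eq]
  simp [Finset.sum_div, neg_div]

-- The law is the image of the standard Gaussian under x ↦ m + S x: positivity makes S the square
-- root of S², and this map multiplies Lebesgue measure by S.det⁻¹.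
open scoped MatrixOrder in
lemma multivariateGaussian_sq_eq_withDensity (m : E k) {S : Matrix (Fin k) (Fin k) ℝ}
    (hS : S.PosDef) :
    multivariateGaussian m (S ^ 2) = volume.withDensity fun x =>
      ENNReal.ofReal ((√(2 * Real.pi))⁻¹ ^ k * S.det⁻¹ *
        Real.exp (-‖Matrix.toEuclideanCLM (𝕜 := ℝ) S⁻¹ (x - m)‖ ^ 2 / 2)) := by
  have hdet := hS.det_pos
  have hsqrt : CFC.sqrt (S ^ 2) = S := CFC.sqrt_sq S hS.posSemidef.nonneg
  have hlin : Measure.map (Matrix.toEuclideanCLM (𝕜 := ℝ) S) (volume : Measure (E k)) =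
      ENNReal.ofReal S.det⁻¹ • volume := by
    have h := Measure.map_linearMap_addHaar_eq_smul_addHaar (volume : Measure (E k))
      (f := Matrix.toEuclideanLin S) (by rw [LinearMap.det_toLpLin]; exact hdet.ne')
    rw [LinearMap.det_toLpLin, abs_of_pos (inv_pos.2 hdet)] at h
    exact h
  have hvol : Measure.map (fun x => m + Matrix.toEuclideanCLM (𝕜 := ℝ) S x)
      (volume : Measure (E k)) = ENNReal.ofReal S.det⁻¹ • volume := by
    rw [show (fun x => m + Matrix.toEuclideanCLM (𝕜 := ℝ) S x) =
        (fun x => m + x) ∘ Matrix.toEuclideanCLM (𝕜 := ℝ) S from rfl,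
      ← Measure.map_map (measurable_const_add m) (by fun_prop), hlin, Measure.map_smul, map_add_left_eq_self]
  have hinv : Function.LeftInverse (fun x => Matrix.toEuclideanCLM (𝕜 := ℝ) S⁻¹ (x - m))
      (fun x : E k => m + Matrix.toEuclideanCLM (𝕜 := ℝ) S x) := fun x => by
    simp only [add_sub_cancel_left]
    rw [← mul_apply_eq_comp, ← map_mul, Matrix.nonsing_inv_mul _ hdet.ne'.isUnit,
      map_one, one_apply_eq_self]
  rw [multivariateGaussian, hsqrt, stdGaussian_eq_withDensity,
    map_withDensity_of_leftInverse _ (by fun_prop) (by fun_prop) hinv (by fun_prop), hvol,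
    withDensity_smul_measure, ← withDensity_smul _ (by fun_prop)]
  congr 1
  ext x
  simp only [Pi.smul_apply, Function.comp, smul_eq_mul]
  rw [← ENNReal.ofReal_mul (inv_pos.2 hdet).le]
  congr 1
  ring

lemma refMeasure_eq_withDensity {ρ : ℝ} (hρ : 0 < ρ) :
    refMeasure k ρ = volume.withDensity fun x =>
      ENNReal.ofReal ((√(2 * Real.pi))⁻¹ ^ k * ((√2 * ρ) ^ k)⁻¹ *
        Real.exp (-‖x‖ ^ 2 / (4 * ρ ^ 2))) := by
  have hc : 0 < √2 * ρ := by positivity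
  have hpd : ((√2 * ρ) • (1 : Matrix (Fin k) (Fin k) ℝ)).PosDef := Matrix.PosDef.one.smul hc
  have hsq : (2 * ρ ^ 2) • (1 : Matrix (Fin k) (Fin k) ℝ) = ((√2 * ρ) • 1) ^ 2 := by
    rw [smul_pow, one_pow, mul_pow, Real.sq_sqrt (by norm_num)]
  have hinv : ((√2 * ρ) • (1 : Matrix (Fin k) (Fin k) ℝ))⁻¹ = (√2 * ρ)⁻¹ • 1 := by
    refine Matrix.inv_eq_left_inv ?_
    rw [smul_mul_smul_comm, mul_one, inv_mul_cancel₀ hc.ne', one_smul]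
  rw [refMeasure, hsq, multivariateGaussian_sq_eq_withDensity 0 hpd]
  congr 1
  ext x
  rw [hinv, Matrix.det_smul, Matrix.det_one, mul_one, Fintype.card_fin, map_smul, map_one,
    sub_zero, smul_apply, one_apply_eq_self, norm_smul,
    mul_pow _ ‖x‖, Real.norm_eq_abs, sq_abs, inv_pow (√2 * ρ) 2, mul_pow (√2) ρ 2, Real.sq_sqrt (by norm_num)]
  congr 3
  field_simp
  ring

instance (ρ : ℝ) : IsProbabilityMeasure (refMeasure k ρ) := by
  unfold refMeasure; infer_instance

/-- Explicit form of the density of `N(m, S²)` with respect to the reference measure. -/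
lemma gaussDensity_ae_eq {ρ : ℝ} (hρ : 0 < ρ) (m : E k) {S : Matrix (Fin k) (Fin k) ℝ}
    (hS : S.PosDef) :
    gaussDensity k ρ (m, S) =ᵐ[refMeasure k ρ] fun x =>
      (√2 * ρ) ^ k / S.det * Real.exp (-‖Matrix.toEuclideanCLM (𝕜 := ℝ) S⁻¹ (x - m)‖ ^ 2 / 2 +
        ‖x‖ ^ 2 / (4 * ρ ^ 2)) := by
  have hdet := hS.det_pos
  have hm : Measurable fun x : E k => ENNReal.ofReal ((√2 * ρ) ^ k / S.det *
      Real.exp (-‖Matrix.toEuclideanCLM (𝕜 := ℝ) S⁻¹ (x - m)‖ ^ 2 / 2 +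
        ‖x‖ ^ 2 / (4 * ρ ^ 2))) := by fun_prop
  -- Both laws have explicit Lebesgue densities, so the claimed ratio is verified by multiplication
  -- and uniqueness of the derivative does the rest.
  have h : multivariateGaussian m (S ^ 2) = (refMeasure k ρ).withDensity fun x =>
      ENNReal.ofReal ((√2 * ρ) ^ k / S.det *
        Real.exp (-‖Matrix.toEuclideanCLM (𝕜 := ℝ) S⁻¹ (x - m)‖ ^ 2 / 2 +
          ‖x‖ ^ 2 / (4 * ρ ^ 2))) := by
    rw [refMeasure_eq_withDensity hρ, ← withDensity_mul _ (by fun_prop) hm,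
      multivariateGaussian_sq_eq_withDensity m hS]
    congr 1
    ext x
    rw [Pi.mul_apply, ← ENNReal.ofReal_mul (by positivity), Real.exp_add, neg_div (4 * ρ ^ 2),
      Real.exp_neg (‖x‖ ^ 2 / (4 * ρ ^ 2))]
    congr 1
    have := Real.exp_pos (‖x‖ ^ 2 / (4 * ρ ^ 2))
    field_simp
  have h2 := Measure.rnDeriv_withDensity (refMeasure k ρ) hm
  rw [← h] at h2
  filter_upwards [h2] with x hx
  simp only [gaussDensity]
  rw [hx, ENNReal.toReal_ofReal (by positivity)]

/-! ### Norm bounds from the spectrum -/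

/-- In an orthonormal eigenbasis S multiplies each coordinate by an eigenvalue. -/
lemma norm_toEuclideanCLM_mem_Icc {S : Matrix (Fin k) (Fin k) ℝ} (hS : S.IsHermitian) {a c : ℝ}
    (ha : 0 ≤ a) (hspec : spectrum ℝ S ⊆ Set.Icc a c) (x : E k) :
    a * ‖x‖ ≤ ‖Matrix.toEuclideanCLM (𝕜 := ℝ) S x‖ ∧
      ‖Matrix.toEuclideanCLM (𝕜 := ℝ) S x‖ ≤ c * ‖x‖ := by
  have hev : ∀ i, hS.eigenvalues i ∈ Set.Icc a c := fun i =>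
    hspec (hS.eigenvalues_mem_spectrum_real i)
  set e := hS.eigenvectorBasis
  have hb : ∀ i, Matrix.toEuclideanCLM (𝕜 := ℝ) S (e i) = hS.eigenvalues i • e i := fun i => by
    have := hS.mulVec_eigenvectorBasis i
    apply (WithLp.equiv 2 _).injective
    simpa using this
  have hrepr : ∀ j, e.repr (Matrix.toEuclideanCLM (𝕜 := ℝ) S x) j =
      hS.eigenvalues j * e.repr x j := fun j => by
    conv_lhs => rw [← e.sum_repr x]
    simp only [map_sum, map_smul, hb]
    simp [OrthonormalBasis.repr_self, Pi.single_apply, mul_comm]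
  have hn : ‖Matrix.toEuclideanCLM (𝕜 := ℝ) S x‖ ^ 2 =
      ∑ j, (hS.eigenvalues j) ^ 2 * (e.repr x j) ^ 2 := by
    rw [← e.repr.norm_map, EuclideanSpace.real_norm_sq_eq]
    simp [hrepr, mul_pow]
  have hx : ‖x‖ ^ 2 = ∑ j, (e.repr x j) ^ 2 := by
    rw [← e.repr.norm_map, EuclideanSpace.real_norm_sq_eq]
  constructor
  · refine le_of_sq_le_sq ?_ (norm_nonneg _)
    rw [mul_pow, hx, hn, Finset.mul_sum]
    refine Finset.sum_le_sum fun j _ => ?_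
    have := (hev j).1
    gcongr
  -- For k = 0 the spectrum is empty and c may be negative; only x = 0 remains.
  · rcases isEmpty_or_nonempty (Fin k) with hk | ⟨⟨j⟩⟩
    · have : x = 0 := Subsingleton.elim _ _
      simp [this]
    · have hc : 0 ≤ c := ha.trans ((hev j).1.trans (hev j).2)
      refine le_of_sq_le_sq ?_ (by positivity)
      rw [mul_pow, hx, hn, Finset.mul_sum]
      refine Finset.sum_le_sum fun j _ => ?_
      have := (hev j).2
      have := ha.trans (hev j).1
      gcongr

lemma pow_le_det_of_spectrum_subset {S : Matrix (Fin k) (Fin k) ℝ} (hS : S.IsHermitian) {a c : ℝ}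
    (ha : 0 ≤ a) (hspec : spectrum ℝ S ⊆ Set.Icc a c) : a ^ k ≤ S.det := by
  rw [hS.det_eq_prod_eigenvalues]
  calc a ^ k = ∏ _i : Fin k, a := by simp
    _ ≤ _ := Finset.prod_le_prod (fun _ _ => ha) fun i _ =>
      (hspec (hS.eigenvalues_mem_spectrum_real i)).1

/-! ### Nets of Gaussian mixtures -/

/-- A bounded set of vectors contains a finite `δ`-net for the supremum norm whose cardinality
is controlled by the dimension. -/
lemma exists_finite_net {P : Type*} [Fintype P] (K : Set (P → ℝ)) {G δ : ℝ}
    (hG : 0 ≤ G) (hδ : 0 < δ) (hK : ∀ c ∈ K, ∀ p, |c p| ≤ G) :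
    ∃ F : Finset (P → ℝ), ↑F ⊆ K ∧ (∀ c ∈ K, ∃ c' ∈ F, ∀ p, |c p - c' p| ≤ δ) ∧
      (F.card : ℝ) ≤ (2 * G / δ + 2) ^ Fintype.card P := by
  classical
  let φ : (P → ℝ) → P → ℤ := fun c p => ⌊c p / δ⌋
  let T : Finset (P → ℤ) := Fintype.piFinset fun _ => Finset.Icc ⌊-G / δ⌋ ⌊G / δ⌋
  have hT : φ '' K ⊆ T := by
    rintro _ ⟨c, hc, rfl⟩
    refine Finset.mem_coe.2 (Fintype.mem_piFinset.2 fun p => Finset.mem_Icc.2 ⟨?_, ?_⟩)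
    · have := (abs_le.1 (hK c hc p)).1
      exact Int.floor_mono (by gcongr)
    · have := (abs_le.1 (hK c hc p)).2
      exact Int.floor_mono (by gcongr)
  -- One point of K is kept in each nonempty grid cell of side δ, so the net stays inside K.
  obtain ⟨K', hK', hbij⟩ := Set.SurjOn.exists_bijOn_subset (Set.surjOn_image φ K)
  have hfin : K'.Finite := Set.Finite.of_finite_image
    ((T.finite_toSet.subset hT).subset hbij.image_eq.subset) hbij.injOn
  refine ⟨hfin.toFinset, by simpa using hK', fun c hc => ?_, ?_⟩
  · obtain ⟨c', hc', h⟩ := hbij.surjOn (Set.mem_image_of_mem φ hc)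
    refine ⟨c', hfin.mem_toFinset.2 hc', fun p => ?_⟩
    have h1 : ⌊c' p / δ⌋ = ⌊c p / δ⌋ := congrFun h p
    have h2 := Int.abs_sub_lt_one_of_floor_eq_floor h1.symm
    rw [← sub_div, abs_div, abs_of_pos hδ, div_lt_one hδ] at h2
    exact h2.le
  · have h1 : hfin.toFinset.card ≤ T.card :=
      Finset.card_le_card_of_injOn φ
        (fun c hc => hT ⟨c, hK' (hfin.mem_toFinset.1 hc), rfl⟩)
        (by simpa using hbij.injOn)
    have h2 : T.card = (⌊G / δ⌋ + 1 - ⌊-G / δ⌋).toNat ^ Fintype.card P := by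
      simp [T, Fintype.card_piFinset]
    calc (hfin.toFinset.card : ℝ) ≤ T.card := by exact_mod_cast h1
      _ = ((⌊G / δ⌋ + 1 - ⌊-G / δ⌋).toNat : ℝ) ^ Fintype.card P := by rw [h2]; push_cast; rfl
      _ ≤ _ := by
        refine pow_le_pow_left₀ (Nat.cast_nonneg _) ?_ _
        have hle : ⌊-G / δ⌋ ≤ ⌊G / δ⌋ := Int.floor_mono (by gcongr; linarith)
        have h3 : (((⌊G / δ⌋ + 1 - ⌊-G / δ⌋).toNat : ℤ) : ℝ) =
            ((⌊G / δ⌋ + 1 - ⌊-G / δ⌋ : ℤ) : ℝ) := by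
          rw [Int.toNat_of_nonneg (by omega)]
        rw [Int.cast_natCast] at h3
        rw [h3]
        push_cast
        have h4 := Int.floor_le (G / δ)
        have h5 := Int.lt_floor_add_one (-G / δ)
        have h6 : -G / δ = -(G / δ) := neg_div _ _
        have h7 : 2 * G / δ = 2 * (G / δ) := mul_div_assoc _ _ _
        linarith

/-! ### Coordinates of Gaussian components and their perturbation. -/

/-- Coordinates of a component `w exp(-‖B z - v‖² / 2 + ‖z‖² / 4)`: `none` stands for `w`,
`(i, none)` for `v i` and `(i, some j)` for `B i j`. -/
abbrev Coord (k : ℕ) : Type := Option (Fin k × Option (Fin k))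

/-- The quadratic form `‖B z - v‖²`. -/
noncomputable def quad (a : Coord k → ℝ) (z : E k) : ℝ :=
  ∑ i, (∑ j, a (some (i, some j)) * z j - a (some (i, none))) ^ 2

/-- The component with coordinates `a`. -/
noncomputable def component (a : Coord k → ℝ) (z : E k) : ℝ :=
  a none * Real.exp (-quad a z / 2 + ‖z‖ ^ 2 / 4)

/-- Coordinates bounded by `e^{2b}` whose quadratic form dominates `‖z - m‖²` for some `m` with
`‖m‖² ≤ 2 b`. -/
structure IsAdmissible (b : ℝ) (a : Coord k → ℝ) : Prop where
  abs_le : ∀ p, |a p| ≤ Real.exp (2 * b)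
  weight_nonneg : 0 ≤ a none
  le_quad : ∃ m : E k, ‖m‖ ^ 2 ≤ 2 * b ∧ ∀ z, ‖z - m‖ ^ 2 ≤ quad a z

lemma measurable_component (a : Coord k → ℝ) : Measurable (component a) := by
  unfold component quad; fun_prop

/-- From ‖z‖² ≤ (4/3) ‖z - m‖² + 4 ‖m‖², the form dominates the growth ‖z‖² / 4 and leaves a
Gaussian margin, which later absorbs the polynomial factors in z. -/
lemma IsAdmissible.exponent_le {b : ℝ} {a : Coord k → ℝ} (ha : IsAdmissible b a) (z : E k) :
    -quad a z / 2 + ‖z‖ ^ 2 / 4 ≤ 3 * b - ‖z‖ ^ 2 / 8 := by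
  obtain ⟨m, hm, h⟩ := ha.le_quad
  have h1 := h z
  have h2 : ‖z‖ ≤ ‖z - m‖ + ‖m‖ := by simpa using norm_add_le (z - m) m
  have h3 : ‖z‖ ^ 2 ≤ (‖z - m‖ + ‖m‖) ^ 2 := pow_le_pow_left₀ (norm_nonneg _) h2 2
  nlinarith [sq_nonneg (‖z - m‖ - 3 * ‖m‖)]

lemma IsAdmissible.component_nonneg {b : ℝ} {a : Coord k → ℝ} (ha : IsAdmissible b a) (z : E k) :
    0 ≤ component a z := mul_nonneg ha.weight_nonneg (Real.exp_pos _).le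

lemma IsAdmissible.component_le {b : ℝ} {a : Coord k → ℝ} (ha : IsAdmissible b a) (z : E k) :
    component a z ≤ Real.exp (2 * b) * Real.exp (3 * b) := by
  refine mul_le_mul ((le_abs_self _).trans (ha.abs_le _)) (Real.exp_le_exp.2 ?_)
    (Real.exp_pos _).le (Real.exp_pos _).le
  have := ha.exponent_le z
  have := sq_nonneg ‖z‖
  linarith

lemma abs_exp_sub_exp_le {x y M : ℝ} (hx : x ≤ M) (hy : y ≤ M) :
    |Real.exp x - Real.exp y| ≤ |x - y| * Real.exp M := by
  wlog h : y ≤ x generalizing x y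
  · rw [abs_sub_comm, abs_sub_comm x]
    exact this hy hx (le_of_not_ge h)
  rw [abs_of_nonneg (sub_nonneg.2 (Real.exp_le_exp.2 h)), abs_of_nonneg (sub_nonneg.2 h)]
  have h1 := Real.add_one_le_exp (y - x)
  have h2 : Real.exp y = Real.exp x * Real.exp (y - x) := by rw [← Real.exp_add]; ring_nf
  have h3 := Real.exp_le_exp.2 hx
  have h4 := Real.exp_pos x
  nlinarith

lemma abs_row_le (c : Fin k → ℝ) (d : ℝ) {η : ℝ} (hc : ∀ j, |c j| ≤ η) (hd : |d| ≤ η)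
    (hk : 1 ≤ k) (z : E k) : |∑ j, c j * z j - d| ≤ k * η * (‖z‖ + 1) := by
  have hη : 0 ≤ η := (abs_nonneg _).trans hd
  have hk' : (1 : ℝ) ≤ k := by exact_mod_cast hk
  have h1 : |∑ j, c j * z j| ≤ k * (η * ‖z‖) := by
    refine (Finset.abs_sum_le_sum_abs _ _).trans ?_
    calc ∑ j, |c j * z j| ≤ ∑ _j : Fin k, η * ‖z‖ := Finset.sum_le_sum fun j _ => by
          rw [abs_mul]
          exact mul_le_mul (hc j) (by simpa using PiLp.norm_apply_le z j) (abs_nonneg _) hη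
      _ = _ := by simp
  have h2 : η ≤ k * η := le_mul_of_one_le_left hη hk'
  calc |∑ j, c j * z j - d| ≤ |∑ j, c j * z j| + |d| := abs_sub _ _
    _ ≤ k * (η * ‖z‖) + k * η := by linarith
    _ = _ := by ring

lemma abs_quad_sub_quad_le {a a' : Coord k → ℝ} {G δ : ℝ} (hk : 1 ≤ k) (ha : ∀ p, |a p| ≤ G)
    (ha' : ∀ p, |a' p| ≤ G) (hδ : ∀ p, |a p - a' p| ≤ δ) (z : E k) :
    |quad a z - quad a' z| ≤ 2 * (k ^ 3 * G * δ * (‖z‖ + 1) ^ 2) := by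
  have hG : 0 ≤ G := (abs_nonneg _).trans (ha none)
  have hδ0 : 0 ≤ δ := (abs_nonneg _).trans (hδ none)
  have hterm : ∀ i : Fin k, |(∑ j, a (some (i, some j)) * z j - a (some (i, none))) ^ 2 -
      (∑ j, a' (some (i, some j)) * z j - a' (some (i, none))) ^ 2| ≤
      (k * δ * (‖z‖ + 1)) * (2 * (k * G * (‖z‖ + 1))) := fun i => by
    have h1 := abs_row_le (fun j => a (some (i, some j))) (a (some (i, none)))
      (fun j => ha _) (ha _) hk z
    have h2 := abs_row_le (fun j => a' (some (i, some j))) (a' (some (i, none)))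
      (fun j => ha' _) (ha' _) hk z
    have h3 := abs_row_le (fun j => a (some (i, some j)) - a' (some (i, some j)))
      (a (some (i, none)) - a' (some (i, none))) (fun j => hδ _) (hδ _) hk z
    have h4 : ∑ j, (a (some (i, some j)) - a' (some (i, some j))) * z j -
        (a (some (i, none)) - a' (some (i, none))) =
        (∑ j, a (some (i, some j)) * z j - a (some (i, none))) -
        (∑ j, a' (some (i, some j)) * z j - a' (some (i, none))) := by
      simp only [sub_mul, Finset.sum_sub_distrib]; ring
    rw [h4] at h3
    rw [sq_sub_sq, mul_comm, abs_mul]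
    refine mul_le_mul h3 ((abs_add_le _ _).trans (by linarith)) (abs_nonneg _) (by positivity)
  rw [quad, quad, ← Finset.sum_sub_distrib]
  refine (Finset.abs_sum_le_sum_abs _ _).trans ((Finset.sum_le_sum fun i _ => hterm i).trans ?_)
  simp only [Finset.sum_const, Finset.card_univ, Fintype.card_fin, nsmul_eq_mul]
  exact le_of_eq (by ring)

/-- The perturbation of the exponent grows like (‖z‖ + 1)², at most 16 exp(‖z‖² / 8), which the
common decay cancels. The exponent 7b collects 2b from the weight, 2b from the entries and 3b from
`IsAdmissible.exponent_le`; 17 is 16 plus 1 for the weight perturbation. -/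
lemma abs_component_sub_le {a a' : Coord k → ℝ} {b δ : ℝ} (hk : 1 ≤ k) (hb : 0 ≤ b)
    (ha : IsAdmissible b a) (ha' : IsAdmissible b a') (hδ : ∀ p, |a p - a' p| ≤ δ) (z : E k) :
    |component a z - component a' z| ≤ 17 * k ^ 3 * Real.exp (7 * b) * δ := by
  have hδ0 : 0 ≤ δ := (abs_nonneg _).trans (hδ none)
  have hk' : (1 : ℝ) ≤ k := by exact_mod_cast hk
  have hk3 : (1 : ℝ) ≤ (k : ℝ) ^ 3 := one_le_pow₀ hk'
  have he := ha.exponent_le z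
  have he' := ha'.exponent_le z
  set x := -quad a z / 2 + ‖z‖ ^ 2 / 4 with hx
  set x' := -quad a' z / 2 + ‖z‖ ^ 2 / 4 with hx'
  have hq := abs_quad_sub_quad_le hk ha.abs_le ha'.abs_le hδ z
  have hxx : |x - x'| ≤ k ^ 3 * Real.exp (2 * b) * δ * (‖z‖ + 1) ^ 2 := by
    have : x - x' = -(quad a z - quad a' z) / 2 := by rw [hx, hx']; ring
    rw [this, abs_div, abs_neg, abs_two]
    linarith
  have hz : (‖z‖ + 1) ^ 2 ≤ 16 * Real.exp (‖z‖ ^ 2 / 8) := by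
    have := Real.add_one_le_exp (‖z‖ ^ 2 / 8)
    nlinarith [sq_nonneg (‖z‖ - 1)]
  have h1 : |Real.exp x - Real.exp x'| ≤ 16 * k ^ 3 * Real.exp (5 * b) * δ := by
    refine (abs_exp_sub_exp_le he he').trans ?_
    calc |x - x'| * Real.exp (3 * b - ‖z‖ ^ 2 / 8) ≤
          k ^ 3 * Real.exp (2 * b) * δ * (16 * Real.exp (‖z‖ ^ 2 / 8)) *
            Real.exp (3 * b - ‖z‖ ^ 2 / 8) := by
          gcongr
          exact hxx.trans (by gcongr)
      _ = 16 * k ^ 3 * δ * (Real.exp (2 * b) * Real.exp (‖z‖ ^ 2 / 8) *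
            Real.exp (3 * b - ‖z‖ ^ 2 / 8)) := by ring
      _ = _ := by
          rw [← Real.exp_add, ← Real.exp_add]
          ring_nf
  have h2 : Real.exp x ≤ Real.exp (7 * b) := by
    refine Real.exp_le_exp.2 ?_
    have := sq_nonneg ‖z‖
    linarith
  have h3 : component a z - component a' z =
      (a none - a' none) * Real.exp x + a' none * (Real.exp x - Real.exp x') := by
    simp only [component, ← hx, ← hx']; ring
  have h4 : Real.exp (2 * b) * Real.exp (5 * b) = Real.exp (7 * b) := by
    rw [← Real.exp_add]; ring_nf
  rw [h3]
  calc |(a none - a' none) * Real.exp x + a' none * (Real.exp x - Real.exp x')| ≤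
        |a none - a' none| * Real.exp x + |a' none| * |Real.exp x - Real.exp x'| := by
        refine (abs_add_le _ _).trans ?_
        rw [abs_mul, abs_mul, Real.abs_exp]
    _ ≤ δ * Real.exp (7 * b) + Real.exp (2 * b) * (16 * k ^ 3 * Real.exp (5 * b) * δ) := by
        gcongr
        · exact hδ none
        · exact ha'.abs_le none
    _ = 1 * (Real.exp (7 * b) * δ) + 16 * k ^ 3 * (Real.exp (2 * b) * Real.exp (5 * b)) * δ := by
        ring
    _ ≤ k ^ 3 * (Real.exp (7 * b) * δ) +
        16 * k ^ 3 * (Real.exp (2 * b) * Real.exp (5 * b)) * δ := by gcongr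
    _ = _ := by rw [h4]; ring

lemma quad_eq_norm_sq {S : Matrix (Fin k) (Fin k) ℝ} {m : E k} {a : Coord k → ℝ} {ρ : ℝ}
    (hv : ∀ i, a (some (i, none)) = Matrix.toEuclideanCLM (𝕜 := ℝ) S m i)
    (hB : ∀ i j, a (some (i, some j)) = ρ * S i j) (z : E k) :
    quad a z = ‖Matrix.toEuclideanCLM (𝕜 := ℝ) S (ρ • z - m)‖ ^ 2 := by
  rw [quad, EuclideanSpace.real_norm_sq_eq]
  refine Finset.sum_congr rfl fun i _ => ?_
  rw [map_sub, map_smul, PiLp.sub_apply, PiLp.smul_apply, hv]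
  congr 2
  simp only [hB, Matrix.ofLp_toEuclideanCLM, Matrix.mulVec, dotProduct, smul_eq_mul,
    Finset.mul_sum, mul_assoc]

lemma log_ratio_bound {r ρlo ρhi : ℝ} (hlo : 0 < ρlo) (hlt : ρlo < ρhi) (k : ℕ) :
    r ^ 2 / (2 * ρhi ^ 2) + k * (Real.log 2 / 2) ≤ bConst k r ρlo ρhi ∧
    (√2 * ρhi / ρlo) ^ k ≤ Real.exp (bConst k r ρlo ρhi) := by
  have hhi : 0 < ρhi := hlo.trans hlt
  have h2 : 0 < √2 := by positivity
  have h1 : √2 ≤ √2 * ρhi / ρlo := by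
    rw [mul_div_assoc]
    exact le_mul_of_one_le_right h2.le ((one_le_div hlo).2 hlt.le)
  constructor
  · rw [bConst]
    have : Real.log 2 / 2 ≤ Real.log (√2 * ρhi / ρlo) := by
      rw [← Real.log_sqrt (by norm_num)]
      exact Real.log_le_log h2 h1
    gcongr
  · rw [bConst, Real.exp_add, Real.exp_nat_mul, Real.exp_log (h2.trans_le h1)]
    exact le_mul_of_one_le_left (by positivity) (Real.one_le_exp (by positivity))

/-- The density of `N(m, Σ²)`, `(m, Σ) ∈ Θ`, is an admissible component in rescaled variables. -/
lemma exists_component_ae_eq (hk : 1 ≤ k) {r ρlo ρhi : ℝ} (hr : 0 < r) (hlo : 0 < ρlo)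
    (hlt : ρlo < ρhi) {θ : E k × Matrix (Fin k) (Fin k) ℝ} (hθ : θ ∈ paramSet k r ρlo ρhi) :
    ∃ a : Coord k → ℝ, IsAdmissible (bConst k r ρlo ρhi) a ∧
      gaussDensity k ρhi θ =ᵐ[refMeasure k ρhi] fun x => component a (ρhi⁻¹ • x) := by
  obtain ⟨m, S⟩ := θ
  obtain ⟨hm, hS, hspec⟩ := hθ
  simp only at hm hS hspec
  have hhi : 0 < ρhi := hlo.trans hlt
  have hdet := hS.det_pos
  have hnorm := norm_toEuclideanCLM_mem_Icc hS.isHermitian hlo.le hspec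
  have hinv : ∀ x : E k, Matrix.toEuclideanCLM (𝕜 := ℝ) S
      (Matrix.toEuclideanCLM (𝕜 := ℝ) S⁻¹ x) = x := fun x => by
    rw [← mul_apply_eq_comp, ← map_mul, Matrix.mul_nonsing_inv _ hdet.ne'.isUnit,
      map_one, one_apply_eq_self]
  have hup : ∀ x : E k, ‖Matrix.toEuclideanCLM (𝕜 := ℝ) S⁻¹ x‖ ≤ ‖x‖ / ρlo := fun x => by
    have := (hnorm (Matrix.toEuclideanCLM (𝕜 := ℝ) S⁻¹ x)).1
    rw [hinv] at this
    rw [le_div_iff₀ hlo]; linarith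
  have hdown : ∀ x : E k, ‖x‖ ≤ ρhi * ‖Matrix.toEuclideanCLM (𝕜 := ℝ) S⁻¹ x‖ := fun x => by
    have := (hnorm (Matrix.toEuclideanCLM (𝕜 := ℝ) S⁻¹ x)).2
    rwa [hinv] at this
  obtain ⟨hb1, hb2⟩ := log_ratio_bound (r := r) hlo hlt k
  set b := bConst k r ρlo ρhi with hb
  have hl2 : 0 ≤ Real.log 2 := Real.log_nonneg (by norm_num)
  have hrb : (r / ρhi) ^ 2 ≤ 2 * b := by
    have h1 : (0 : ℝ) ≤ k * (Real.log 2 / 2) := by positivity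
    have h2 : r ^ 2 / (2 * ρhi ^ 2) = (r / ρhi) ^ 2 / 2 := by field_simp
    linarith
  have hb0 : 0 ≤ b := by linarith [sq_nonneg (r / ρhi)]
  have hratio : ρhi / ρlo ≤ Real.exp b := by
    have h1 : 1 ≤ ρhi / ρlo := (one_le_div hlo).2 hlt.le
    have h2 : (1 : ℝ) ≤ √2 := Real.one_le_sqrt.2 (by norm_num)
    have h3 : ρhi / ρlo ≤ √2 * ρhi / ρlo := by
      rw [mul_div_assoc]; exact le_mul_of_one_le_left (by linarith) h2
    calc ρhi / ρlo ≤ √2 * ρhi / ρlo := h3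
      _ ≤ (√2 * ρhi / ρlo) ^ k := le_self_pow₀ (h1.trans h3) (by omega)
      _ ≤ _ := hb2
  have hrexp : r / ρhi ≤ Real.exp b := by
    refine le_of_sq_le_sq ?_ (Real.exp_pos _).le
    rw [← Real.exp_nat_mul]
    have := Real.add_one_le_exp (2 * b)
    push_cast
    linarith
  have hexp2 : Real.exp (2 * b) = Real.exp b * Real.exp b := by rw [← Real.exp_add]; ring_nf
  have hexp1 : Real.exp b ≤ Real.exp (2 * b) := Real.exp_le_exp.2 (by linarith)
  -- The coordinates use S⁻¹ rather than S, so that the exponent is a polynomial in them.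
  let a : Coord k → ℝ := fun p => match p with
    | none => (√2 * ρhi) ^ k / S.det
    | some (i, none) => Matrix.toEuclideanCLM (𝕜 := ℝ) S⁻¹ m i
    | some (i, some j) => ρhi * S⁻¹ i j
  have hquad : ∀ z : E k, quad a z = ‖Matrix.toEuclideanCLM (𝕜 := ℝ) S⁻¹ (ρhi • z - m)‖ ^ 2 :=
    quad_eq_norm_sq (a := a) (fun _ => rfl) (fun _ _ => rfl)
  refine ⟨a, ⟨?_, ?_, ρhi⁻¹ • m, ?_, ?_⟩, ?_⟩
  · rintro (_ | ⟨i, _ | j⟩)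
    · change |(√2 * ρhi) ^ k / S.det| ≤ _
      rw [abs_of_nonneg (by positivity)]
      have := pow_le_det_of_spectrum_subset hS.isHermitian hlo.le hspec
      calc (√2 * ρhi) ^ k / S.det ≤ (√2 * ρhi) ^ k / ρlo ^ k := by gcongr
        _ = (√2 * ρhi / ρlo) ^ k := (div_pow _ _ _).symm
        _ ≤ _ := hb2.trans hexp1
    · change |Matrix.toEuclideanCLM (𝕜 := ℝ) S⁻¹ m i| ≤ _
      calc |Matrix.toEuclideanCLM (𝕜 := ℝ) S⁻¹ m i| ≤ ‖Matrix.toEuclideanCLM (𝕜 := ℝ) S⁻¹ m‖ := by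
            simpa using PiLp.norm_apply_le (Matrix.toEuclideanCLM (𝕜 := ℝ) S⁻¹ m) i
        _ ≤ ‖m‖ / ρlo := hup m
        _ ≤ r / ρlo := by gcongr
        _ = r / ρhi * (ρhi / ρlo) := by field_simp
        _ ≤ Real.exp b * Real.exp b := by gcongr
        _ = _ := hexp2.symm
    · change |ρhi * S⁻¹ i j| ≤ _
      have h1 : Matrix.toEuclideanCLM (𝕜 := ℝ) S⁻¹ (EuclideanSpace.single j 1) i = S⁻¹ i j := by
        simp [Matrix.ofLp_toEuclideanCLM]
      have h2 : |S⁻¹ i j| ≤ 1 / ρlo := by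
        rw [← h1]
        calc |Matrix.toEuclideanCLM (𝕜 := ℝ) S⁻¹ (EuclideanSpace.single j 1) i| ≤
              ‖Matrix.toEuclideanCLM (𝕜 := ℝ) S⁻¹ (EuclideanSpace.single j 1)‖ := by
              simpa using PiLp.norm_apply_le
                (Matrix.toEuclideanCLM (𝕜 := ℝ) S⁻¹ (EuclideanSpace.single j 1)) i
          _ ≤ ‖EuclideanSpace.single j (1 : ℝ)‖ / ρlo := hup _
          _ = _ := by simp
      rw [abs_mul, abs_of_pos hhi]
      calc ρhi * |S⁻¹ i j| ≤ ρhi * (1 / ρlo) := by gcongr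
        _ = ρhi / ρlo := by ring
        _ ≤ _ := hratio.trans hexp1
  · change 0 ≤ (√2 * ρhi) ^ k / S.det
    positivity
  · rw [norm_smul, mul_pow, norm_inv, Real.norm_eq_abs, abs_of_pos hhi]
    calc ρhi⁻¹ ^ 2 * ‖m‖ ^ 2 ≤ ρhi⁻¹ ^ 2 * r ^ 2 := by gcongr
      _ = (r / ρhi) ^ 2 := by ring
      _ ≤ _ := hrb
  -- S⁻¹ expands norms by at least 1 / ρhi, and the rescaling by ρhi turns this into a factor of at
  -- least 1.
  · intro z
    rw [hquad]
    have h1 := hdown (ρhi • z - m)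
    have h2 : z - ρhi⁻¹ • m = ρhi⁻¹ • (ρhi • z - m) := by
      rw [smul_sub, smul_smul, inv_mul_cancel₀ hhi.ne', one_smul]
    rw [h2, norm_smul, norm_inv, Real.norm_eq_abs, abs_of_pos hhi]
    refine pow_le_pow_left₀ (by positivity) ?_ 2
    rw [inv_mul_le_iff₀ hhi]
    exact h1
  · refine (gaussDensity_ae_eq hhi m hS).trans (.of_forall fun x => ?_)
    simp only [component, hquad, smul_smul, mul_inv_cancel₀ hhi.ne', one_smul]
    change _ = (√2 * ρhi) ^ k / S.det * _
    congr 2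
    rw [norm_smul, norm_inv, Real.norm_eq_abs, abs_of_pos hhi]
    field_simp

/-- The mixture `∑ j, component (c (j, ·))`. -/
noncomputable def mixture {l : ℕ} (c : Fin l × Coord k → ℝ) (z : E k) : ℝ :=
  ∑ j, component (fun p => c (j, p)) z

/-- Every `g ∘ u` with `g` in the link set and `u ∈ T^l` is an admissible mixture. -/
lemma exists_mixture_ae_eq (hk : 1 ≤ k) {l : ℕ} {r ρlo ρhi : ℝ} (hr : 0 < r) (hlo : 0 < ρlo)
    (hlt : ρlo < ρhi) {g : (Fin l → ℝ) → ℝ} (hg : g ∈ linkSet k l r ρlo ρhi)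
    {u : Fin l → E k → ℝ} (hu : ∀ j, u j ∈ funSet k r ρlo ρhi) :
    ∃ c : Fin l × Coord k → ℝ, (∀ j, IsAdmissible (bConst k r ρlo ρhi) fun p => c (j, p)) ∧
      (fun x => g fun j => u j x) =ᵐ[refMeasure k ρhi] fun x => mixture c (ρhi⁻¹ • x) := by
  obtain ⟨q, ⟨hq0, hq1⟩, rfl⟩ := hg
  choose θ hθ hu using hu
  choose a ha hae using fun j => exists_component_ae_eq hk hr hlo hlt (hθ j)
  set b := bConst k r ρlo ρhi
  have hqle : ∀ j, q j ≤ 1 := fun j => by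
    rw [← hq1]; exact Finset.single_le_sum (fun i _ => hq0 i) (Finset.mem_univ j)
  -- The mixing weight q j is folded into the component's weight, so it needs no separate net; e^b
  -- cancels the square of e^{-b/2}.
  refine ⟨fun p => match p.2 with
    | none => q p.1 * a p.1 none
    | some y => a p.1 (some y), fun j => ⟨?_, ?_, ?_⟩, ?_⟩
  · rintro (_ | y)
    · change |q j * a j none| ≤ _
      rw [abs_mul, abs_of_nonneg (hq0 j)]
      exact (mul_le_of_le_one_left (abs_nonneg _) (hqle j)).trans ((ha j).abs_le none)
    · exact (ha j).abs_le (some y)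
  · exact mul_nonneg (hq0 j) (ha j).weight_nonneg
  · exact (ha j).le_quad
  · filter_upwards [ae_all_iff.2 hae] with x hx
    refine Finset.sum_congr rfl fun j _ => ?_
    have hp : 0 ≤ gaussDensity k ρhi (θ j) x := ENNReal.toReal_nonneg
    have he : Real.exp b * Real.exp (-b / 2) ^ 2 = 1 := by
      rw [← Real.exp_nat_mul, ← Real.exp_add]; push_cast; ring_nf; simp
    rw [hu j]
    simp only
    rw [mul_pow, Real.sq_sqrt hp, hx j]
    change _ = q j * a j none * Real.exp (-quad (a j) (ρhi⁻¹ • x) / 2 + ‖ρhi⁻¹ • x‖ ^ 2 / 4)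
    simp only [component]
    linear_combination (q j * (a j none * Real.exp (-quad (a j) (ρhi⁻¹ • x) / 2 +
      ‖ρhi⁻¹ • x‖ ^ 2 / 4))) * he

/-- Zero weights with B the identity; this point guarantees that the net is nonempty. -/
lemma exists_admissible (l : ℕ) {b : ℝ} (hb : 0 ≤ b) :
    ∃ c : Fin l × Coord k → ℝ, ∀ j, IsAdmissible b fun p => c (j, p) := by
  classical
  refine ⟨fun p => match p.2 with
    | some (i, some j) => if j = i then 1 else 0
    | _ => 0, fun j => ⟨?_, le_rfl, 0, by simpa using hb, fun z => ?_⟩⟩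
  · have h1 : 1 ≤ Real.exp (2 * b) := Real.one_le_exp (by linarith)
    rintro (_ | ⟨i, _ | j⟩)
    · simpa using by linarith
    · simpa using by linarith
    · by_cases h : j = i
      · simpa [h] using h1
      · simpa [h] using by linarith
  · simp [quad, EuclideanSpace.real_norm_sq_eq]

/-- A finite net of admissible mixtures for the supremum norm. -/
lemma exists_mixture_net {l n : ℕ} (hk : 1 ≤ k) (hl : 1 ≤ l) (hn : 1 ≤ n) {b : ℝ}
    (hkb : (k : ℝ) ≤ 3 * b) :
    ∃ F : Finset (Fin l × Coord k → ℝ), F.Nonempty ∧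
      (∀ c ∈ F, ∀ j, IsAdmissible b fun p => c (j, p)) ∧
      (∀ c : Fin l × Coord k → ℝ, (∀ j, IsAdmissible b fun p => c (j, p)) →
        ∃ c' ∈ F, ∀ z, |mixture c z - mixture c' z| ≤ (n : ℝ)⁻¹) ∧
      Real.log F.card ≤
        36 * (l * k * (k + 1)) * (1 + b + Real.log n + Real.log l) := by
  have hk' : (1 : ℝ) ≤ k := by exact_mod_cast hk
  have hl' : (1 : ℝ) ≤ l := by exact_mod_cast hl
  have hn' : (1 : ℝ) ≤ n := by exact_mod_cast hn
  have hb : 0 ≤ b := by linarith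
  -- D⁻¹ is the mesh at which l components, each with the Lipschitz constant of
  -- `abs_component_sub_le`, add up to an error 1 / n.
  set D : ℝ := 17 * l * k ^ 3 * Real.exp (7 * b) * n with hD
  have hD0 : 0 < D := by positivity
  obtain ⟨F, hF, hnet, hcard⟩ := exists_finite_net
    {c : Fin l × Coord k → ℝ | ∀ j, IsAdmissible b fun p => c (j, p)}
    (Real.exp_pos (2 * b)).le (inv_pos.2 hD0) (fun c hc p => (hc p.1).abs_le p.2)
  obtain ⟨c₀, hc₀⟩ := exists_admissible (k := k) l hb
  obtain ⟨c₁, hc₁, -⟩ := hnet c₀ hc₀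
  refine ⟨F, ⟨c₁, hc₁⟩, fun c hc => hF hc, fun c hc => ?_, ?_⟩
  · obtain ⟨c', hc', h⟩ := hnet c hc
    refine ⟨c', hc', fun z => ?_⟩
    rw [mixture, mixture, ← Finset.sum_sub_distrib]
    refine (Finset.abs_sum_le_sum_abs _ _).trans
      ((Finset.sum_le_sum fun j _ => abs_component_sub_le hk hb (hc j) (hF hc' j)
        (fun p => h (j, p)) z).trans ?_)
    simp only [Finset.sum_const, Finset.card_univ, Fintype.card_fin, nsmul_eq_mul]
    rw [hD]
    have := Real.exp_pos (7 * b)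
    exact le_of_eq (by field_simp)
  · have hcardP : Fintype.card (Fin l × Coord k) = l * (k * (k + 1) + 1) := by
      simp [Coord]
    have hF0 : (0 : ℝ) < F.card := by exact_mod_cast Finset.card_pos.2 ⟨c₁, hc₁⟩
    set G : ℝ := 2 * Real.exp (2 * b) / D⁻¹ + 2 with hG
    have hGle : G ≤ 36 * l * k ^ 3 * Real.exp (9 * b) * n := by
      have h1 : 2 * Real.exp (2 * b) / D⁻¹ = 34 * l * k ^ 3 * Real.exp (9 * b) * n := by
        rw [div_inv_eq_mul, hD, show 9 * b = 2 * b + 7 * b by ring, Real.exp_add]; ring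
      have h2 : 1 ≤ l * k ^ 3 * Real.exp (9 * b) * n := by
        have h3 : (1 : ℝ) ≤ k ^ 3 := one_le_pow₀ hk'
        have h4 : 1 ≤ Real.exp (9 * b) := Real.one_le_exp (by linarith)
        exact one_le_mul_of_one_le_of_one_le (one_le_mul_of_one_le_of_one_le
          (one_le_mul_of_one_le_of_one_le hl' h3) h4) hn'
      rw [hG, h1]; linarith
    have hG1 : 1 ≤ G := by
      have : 0 ≤ 2 * Real.exp (2 * b) / D⁻¹ := by positivity
      linarith
    have hG0 : 0 < G := by linarith
    have hlogG0 := Real.log_nonneg hG1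
    -- The term 3 log k is at most 3k ≤ 9b, which joins the exponent 9b to give 18b.
    have hlogG : Real.log G ≤ 18 * (1 + b + Real.log n + Real.log l) := by
      refine (Real.log_le_log hG0 hGle).trans ?_
      rw [Real.log_mul (by positivity) (by positivity), Real.log_mul (by positivity) (by positivity),
        Real.log_mul (by positivity) (by positivity), Real.log_mul (by positivity) (by positivity),
        Real.log_exp, Real.log_pow]
      have h36 : Real.log 36 ≤ 18 := by
        rw [Real.log_le_iff_le_exp (by norm_num)]
        have := Real.add_one_le_exp (3 : ℝ)
        have h4 : (4 : ℝ) ≤ Real.exp 3 := by linarith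
        calc (36 : ℝ) ≤ 4 ^ 6 := by norm_num
          _ ≤ Real.exp 3 ^ 6 := by gcongr
          _ = Real.exp 18 := by rw [← Real.exp_nat_mul]; norm_num
      have hlk : Real.log k ≤ k - 1 := Real.log_le_sub_one_of_pos (by linarith)
      have := Real.log_nonneg hl'
      have := Real.log_nonneg hn'
      push_cast
      linarith
    calc Real.log F.card ≤ Real.log (G ^ Fintype.card (Fin l × Coord k)) :=
          Real.log_le_log hF0 hcard
      _ = (l * (k * (k + 1) + 1) : ℝ) * Real.log G := by
          rw [Real.log_pow, hcardP]; push_cast; ring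
      _ ≤ (2 * (l * k * (k + 1)) : ℝ) * (18 * (1 + b + Real.log n + Real.log l)) := by
          have := Real.log_nonneg hl'
          have := Real.log_nonneg hn'
          have h1 : (1 : ℝ) ≤ k * (k + 1) := by nlinarith
          have h2 : (l * (k * (k + 1) + 1) : ℝ) ≤ 2 * (l * k * (k + 1)) := by nlinarith
          gcongr
      _ = _ := by ring

/-! ### Comparison of the entropy with the logarithmic factor. -/

/-- Its logarithm bounds the denominator in 𝓛(τ): log(1 + k(k + 1)) ≤ log 8 + (k / 2) log 2 ≤ log 8
+ b, so one of the two b's in e^{2b} survives. -/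
lemma sq_le_mul_two_pow (k : ℕ) : (1 + k * (k + 1)) ^ 2 ≤ 64 * 2 ^ k := by
  rcases lt_or_ge k 6 with hk | hk
  · interval_cases k <;> norm_num
  · induction k, hk using Nat.le_induction with
    | base => norm_num
    | succ k hk ih =>
      have h : (1 + (k + 1) * (k + 1 + 1)) ^ 2 ≤ 2 * (1 + k * (k + 1)) ^ 2 := by
        zify at hk ⊢
        nlinarith [mul_nonneg (sub_nonneg.2 hk) (sub_nonneg.2 hk),
          mul_nonneg (mul_nonneg (sub_nonneg.2 hk) (sub_nonneg.2 hk)) (sub_nonneg.2 hk),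
          mul_nonneg (mul_nonneg (sub_nonneg.2 hk) (sub_nonneg.2 hk))
            (mul_nonneg (sub_nonneg.2 hk) (sub_nonneg.2 hk))]
      rw [pow_succ 2 k]
      linarith

/-- The logarithmic factor of the risk bound dominates `b + log n + log l`. -/
lemma add_log_le_mul_logTerm {k l n : ℕ} (hl : 1 ≤ l) (hn : 1 ≤ n) {r ρlo ρhi A : ℝ}
    (hkb : k * (Real.log 2 / 2) ≤ bConst k r ρlo ρhi) (hA : 1 ≤ A) :
    bConst k r ρlo ρhi + Real.log n + Real.log l ≤ 5 * (max 1 (Real.log A) *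
      max (logTerm k l r ρlo ρhi ((n : ℝ)⁻¹ * A * max 1 (Real.log A))) 1) := by
  have hl' : (1 : ℝ) ≤ l := by exact_mod_cast hl
  have hn' : (1 : ℝ) ≤ n := by exact_mod_cast hn
  set b := bConst k r ρlo ρhi with hb
  set v := max 1 (Real.log A) with hv
  have hv1 : 1 ≤ v := le_max_left _ _
  have hvA : Real.log A ≤ v := le_max_right _ _
  have hq : (0 : ℝ) < 1 + k * (k + 1) := by positivity
  have hlq : Real.log (1 + k * (k + 1)) ≤ Real.log 8 + b := by
    have h1 : ((1 + k * (k + 1) : ℝ)) ^ 2 ≤ 8 ^ 2 * 2 ^ k := by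
      have := sq_le_mul_two_pow k
      norm_num
      exact_mod_cast this
    have h2 := Real.log_le_log (by positivity) h1
    rw [Real.log_pow, Real.log_mul (by norm_num) (by positivity), Real.log_pow, Real.log_pow] at h2
    push_cast at h2
    linarith
  have hL : 2 * logTerm k l r ρlo ρhi ((n : ℝ)⁻¹ * A * v) = Real.log 4 + Real.log l + 2 * b +
      Real.log n - Real.log A - Real.log v - Real.log (1 + k * (k + 1)) := by
    have hA0 : 0 < A := by linarith
    have hv0 : 0 < v := by linarith
    rw [logTerm, ← hb, Real.log_div (by positivity) hq.ne', Real.log_mul (by positivity)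
      (by positivity), Real.log_mul (by positivity) (by positivity), Real.log_mul (by positivity)
      (by positivity), Real.log_inv, Real.log_mul (by positivity) (by positivity), Real.log_mul
      (by positivity) (by positivity), Real.log_inv, Real.log_exp]
    ring
  have h8 : Real.log 8 = Real.log 4 + Real.log 2 := by
    rw [← Real.log_mul (by norm_num) (by norm_num)]; norm_num
  have h2 : Real.log 2 ≤ 1 := by linarith [Real.log_two_lt_d9]
  have hlv : Real.log v ≤ v := by
    have := Real.log_le_sub_one_of_pos (show 0 < v by linarith)
    linarith
  set L := max (logTerm k l r ρlo ρhi ((n : ℝ)⁻¹ * A * v)) 1 with hLdef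
  have hL1 : 1 ≤ L := le_max_right _ _
  have hLL : logTerm k l r ρlo ρhi ((n : ℝ)⁻¹ * A * v) ≤ L := le_max_left _ _
  -- The left side is at most 2L + 2v + 1, and (L - 1)(v - 1) ≥ 0 bounds this by 2vL + 3 ≤ 5vL.
  nlinarith [mul_nonneg (sub_nonneg.2 hL1) (sub_nonneg.2 hv1)]

variable {l : ℕ}

lemma measurable_mixture (c : Fin l × Coord k → ℝ) (ρ : ℝ) :
    Measurable fun x : E k => mixture c (ρ • x) :=
  Finset.measurable_sum _ fun j _ => (measurable_component _).comp (by fun_prop)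

lemma mixture_nonneg {b : ℝ} {c : Fin l × Coord k → ℝ}
    (hc : ∀ j, IsAdmissible b fun p => c (j, p)) (z : E k) : 0 ≤ mixture c z :=
  Finset.sum_nonneg fun j _ => (hc j).component_nonneg z

lemma mixture_le {b : ℝ} {c : Fin l × Coord k → ℝ}
    (hc : ∀ j, IsAdmissible b fun p => c (j, p)) (z : E k) :
    mixture c z ≤ l * (Real.exp (2 * b) * Real.exp (3 * b)) := by
  refine (Finset.sum_le_sum fun j _ => (hc j).component_le z).trans ?_
  simp

lemma memLp_mixture {μ : Measure (E k)} [IsProbabilityMeasure μ] {b : ℝ}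
    {c : Fin l × Coord k → ℝ} (hc : ∀ j, IsAdmissible b fun p => c (j, p)) (ρ : ℝ) :
    MemLp (fun x => mixture c (ρ • x)) 2 μ :=
  memLp_two_of_bounded (measurable_mixture c ρ) fun x => by
    rw [abs_of_nonneg (mixture_nonneg hc _)]
    exact mixture_le hc _

end GaussianMixture

/-! ### The risk bound. -/

theorem mainTheorem9 :
    ∃ C : ℝ, 0 < C ∧
      ∀ (k l n : ℕ), 1 ≤ k → 1 ≤ l → 1 ≤ n →
      ∀ (r ρlo ρhi : ℝ), 0 < r → 0 < ρlo → ρlo < ρhi →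
      ∃ shat : (Fin n → EuclideanSpace ℝ (Fin k)) → MeasureTheory.Lp ℝ 2 (refMeasure k ρhi),
        MeasureTheory.StronglyMeasurable shat ∧
        ∀ s : EuclideanSpace ℝ (Fin k) → ℝ, IsBoundedDensity (refMeasure k ρhi) s →
          ENNReal.ofReal C * risk (refMeasure k ρhi) n s shat ≤
            approxError k l r ρlo ρhi s +
              ENNReal.ofReal
                (l * k * (k + 1) * tau (refMeasure k ρhi) n s *
                  (Real.log (1 + 2 * MConst k r ρhi * RConst k r ρlo ρhi) +
                    max (logTerm k l r ρlo ρhi (tau (refMeasure k ρhi) n s)) 1)) := by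
  -- The final bound is 6D plus (6 + 768 · 217) times the variance term, and 6 + 768 · 217 = 166662
  -- < 200000.
  refine ⟨1 / 200000, by norm_num, fun k l n hk hl hn r ρlo ρhi hr hlo hlt => ?_⟩
  have hhi : 0 < ρhi := hlo.trans hlt
  have hk' : (1 : ℝ) ≤ k := by exact_mod_cast hk
  have hl' : (1 : ℝ) ≤ l := by exact_mod_cast hl
  have hn' : (1 : ℝ) ≤ n := by exact_mod_cast hn
  have hbk := (log_ratio_bound (r := r) hlo hlt k).1
  have hrr : 0 ≤ r ^ 2 / (2 * ρhi ^ 2) := by positivity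
  set b := bConst k r ρlo ρhi with hbdef
  -- This uses b ≥ k (log 2) / 2 and (log 2) / 2 > 1/3.
  have hkb : (k : ℝ) ≤ 3 * b := by nlinarith [Real.log_two_gt_d9]
  obtain ⟨F, hFne, hF, hnet, hcard⟩ := exists_mixture_net hk hl hn hkb
  have : Nonempty F := hFne.to_subtype
  obtain ⟨shat, hmeas, hrisk⟩ := exists_estimator_of_finite_family (μ := refMeasure k ρhi)
    (fun c : F => measurable_mixture c.1 ρhi⁻¹) (fun c x => mixture_nonneg (hF c.1 c.2) _)
    (fun c x => mixture_le (hF c.1 c.2) _) hn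
  refine ⟨shat, hmeas, fun s hs => ?_⟩
  have hA := hs.one_le_supNorm
  rw [Fintype.card_coe] at hrisk
  -- With the variance term on the left, the infimum is bounded candidate by candidate and need not
  -- be attained.
  rw [← tsub_le_iff_right, approxError]
  refine le_iInf₂ fun g hg => le_iInf₂ fun u hu => ?_
  rw [tsub_le_iff_right]
  obtain ⟨c, hc, hcae⟩ := exists_mixture_ae_eq hk hr hlo hlt hg hu
  obtain ⟨c', hc', hcc'⟩ := hnet c hc
  have hrc := hrisk s hs ⟨c', hc'⟩
  have hcL : MemLp (fun x => mixture c (ρhi⁻¹ • x)) 2 (refMeasure k ρhi) := memLp_mixture hc _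
  have hcL' : MemLp (fun x => mixture c' (ρhi⁻¹ • x)) 2 (refMeasure k ρhi) :=
    memLp_mixture (hF c' hc') _
  have hdist : l2dist (refMeasure k ρhi) s (fun x => g fun j => u j x) =
      l2dist (refMeasure k ρhi) s (fun x => mixture c (ρhi⁻¹ • x)) :=
    eLpNorm_congr_ae (hcae.mono fun x hx => by simp only at hx ⊢; rw [hx])
  rw [hdist, l2dist_sq_eq_ofReal hs.memLp_two hcL]
  have hD : ∫ x, (s x - mixture c' (ρhi⁻¹ • x)) ^ 2 ∂(refMeasure k ρhi) ≤
      2 * ∫ x, (s x - mixture c (ρhi⁻¹ • x)) ^ 2 ∂(refMeasure k ρhi) + 2 * (n : ℝ)⁻¹ ^ 2 := by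
    have hi : Integrable (fun x => 2 * (s x - mixture c (ρhi⁻¹ • x)) ^ 2) (refMeasure k ρhi) :=
      (hs.memLp_two.sub hcL).integrable_sq.const_mul 2
    have he : ∫ x, (2 * (s x - mixture c (ρhi⁻¹ • x)) ^ 2 + 2 * (n : ℝ)⁻¹ ^ 2) ∂(refMeasure k ρhi) =
        2 * ∫ x, (s x - mixture c (ρhi⁻¹ • x)) ^ 2 ∂(refMeasure k ρhi) + 2 * (n : ℝ)⁻¹ ^ 2 := by
      rw [integral_add hi (integrable_const _), integral_const_mul]
      simp
    rw [← he]
    refine integral_mono (hs.memLp_two.sub hcL').integrable_sq (hi.add (integrable_const _))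
      fun x => ?_
    have h1 := abs_le.1 (hcc' (ρhi⁻¹ • x))
    have h2 : (mixture c (ρhi⁻¹ • x) - mixture c' (ρhi⁻¹ • x)) ^ 2 ≤ (n : ℝ)⁻¹ ^ 2 :=
      sq_le_sq' h1.1 h1.2
    change (s x - mixture c' (ρhi⁻¹ • x)) ^ 2 ≤
      2 * (s x - mixture c (ρhi⁻¹ • x)) ^ 2 + 2 * (n : ℝ)⁻¹ ^ 2
    nlinarith [sq_nonneg ((s x - mixture c (ρhi⁻¹ • x)) -
      (mixture c (ρhi⁻¹ • x) - mixture c' (ρhi⁻¹ • x)))]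
  have hlog := add_log_le_mul_logTerm (r := r) (ρlo := ρlo) (ρhi := ρhi) hl hn
    (by rw [← hbdef]; linarith) hA
  simp only [tau]
  rw [← hbdef] at hlog
  set A := supNorm (refMeasure k ρhi) s with hAdef
  set v := max 1 (Real.log A) with hv
  have hv1 : 1 ≤ v := le_max_left _ _
  set L := max (logTerm k l r ρlo ρhi ((n : ℝ)⁻¹ * A * v)) 1 with hLdef
  have hL1 : 1 ≤ L := le_max_right _ _
  set D := ∫ x, (s x - mixture c (ρhi⁻¹ • x)) ^ 2 ∂(refMeasure k ρhi) with hDdef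
  have hD0 : 0 ≤ D := integral_nonneg fun x => sq_nonneg _
  -- Only the sign of this term matters: the entropy of the net is already controlled by v and L.
  have hMR : 0 ≤ Real.log (1 + 2 * MConst k r ρhi * RConst k r ρlo ρhi) := by
    refine Real.log_nonneg ?_
    have : 0 ≤ 2 * MConst k r ρhi * RConst k r ρlo ρhi := by
      unfold MConst RConst; positivity
    linarith
  set H := Real.log (1 + 2 * MConst k r ρhi * RConst k r ρlo ρhi)
  set d : ℝ := l * k * (k + 1) with hd
  have hd1 : 1 ≤ d := by
    have h1 : (1 : ℝ) ≤ l * k := one_le_mul_of_one_le_of_one_le hl' hk'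
    exact one_le_mul_of_one_le_of_one_le h1 (by linarith)
  have hnA : 0 < (n : ℝ)⁻¹ * A := by positivity
  rw [← ENNReal.ofReal_add hD0 (by positivity)]
  refine (mul_le_mul_right hrc _).trans ?_
  rw [← ENNReal.ofReal_mul (by norm_num)]
  refine ENNReal.ofReal_le_ofReal ?_
  have hvL1 : 1 ≤ v * L := one_le_mul_of_one_le_of_one_le hv1 hL1
  have hdvL : v * L ≤ d * (v * L) := le_mul_of_one_le_left (by linarith) hd1
  have hN : Real.log F.card ≤ 216 * (d * (v * L)) := by
    refine hcard.trans ?_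
    calc 36 * d * (1 + b + Real.log n + Real.log l) ≤ 36 * d * (6 * (v * L)) := by
          gcongr; linarith
      _ = _ := by ring
  have hvle : v ≤ d * (v * L) := (le_mul_of_one_le_right (by linarith) hL1).trans hdvL
  have hninv : (n : ℝ)⁻¹ ^ 2 ≤ (n : ℝ)⁻¹ * A * (d * (v * L)) := by
    have h1 : (n : ℝ)⁻¹ ≤ 1 := inv_le_one_of_one_le₀ hn'
    have h2 : 0 < (n : ℝ)⁻¹ := by positivity
    have h3 : 1 ≤ d * (v * L) := hvL1.trans hdvL
    calc (n : ℝ)⁻¹ ^ 2 = (n : ℝ)⁻¹ * (n : ℝ)⁻¹ * 1 := by ring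
      _ ≤ (n : ℝ)⁻¹ * A * (d * (v * L)) := by gcongr; linarith
  have hmain : (n : ℝ)⁻¹ * A * (Real.log F.card + v) ≤
      (n : ℝ)⁻¹ * A * (217 * (d * (v * L))) := by
    gcongr; linarith
  have hT : (n : ℝ)⁻¹ * A * (d * (v * L)) ≤ d * ((n : ℝ)⁻¹ * A * v) * (H + L) := by
    have h1 : 0 ≤ d * ((n : ℝ)⁻¹ * A * v) := by positivity
    calc (n : ℝ)⁻¹ * A * (d * (v * L)) = d * ((n : ℝ)⁻¹ * A * v) * L := by ring
      _ ≤ _ := by gcongr; linarith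
  have hP0 : 0 ≤ (n : ℝ)⁻¹ * A * (d * (v * L)) := by positivity
  linarith
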